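/- For $s\in\mathbb C$ let ${\rm li}_s$ be the tempered distribution $\gamma_+^s * {\rm PV}\frac{1}{e^{-x}-1}$ on $\mathbb R$, where $\gamma_+^s(x)=x_+^{s-1}/\Gamma(s)$ (continued entirely in $s$); that is, for every Schwartz function $\varphi$, $$\langle {\rm li}_s,\varphi\rangle={\rm PV}\!\int_{-\infty}^{\infty}\frac{\langle\gamma_+^s,\varphi(\cdot+t)\rangle}{e^{-t}-1}\,dt .$$ Let $B_k$ be the Bernoulli numbers with $\sum_{k\ge0}B_kt^k/k!=t/(1-e^{-t})$ (so $B_1=\tfrac12$), let $B^m(q)$ be the polynomials with $\sum_{m\ge 0}B^m(q)t^m/m!=te^{(q+1)t}/(e^t-1)$, and for an integer $n\ge 0$ put $$\lambda i_n=\sum_{0\le k\le n-1}B_k\frac{(-2x)^k}{k!}\cdot{\rm li}_{n-k}.$$ Let ${\rm Li}_m$ be the classical polylogarithm ($\sum_{j\ge1}z^j/j^m$ for $|z|<1$, continued to $\mathbb C\setminus[1,\infty)$, and on $(1,\infty)$ given by a boundary value from one side of the cut; its real part there does not depend on the side). 1. If $n$ is even, the distribution $\lambda i_n$ is a smooth function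 on $\mathbb R$: there is a real-valued $f\in C^\infty(\mathbb R)$ such that, for every Schwartz function $\varphi$, $f\varphi$ is integrable and $\langle\lambda i_n,\varphi\rangle=\int f\varphi\,dx$. Moreover, this recovers the smoothness of the classical modified polylogarithm along the positive real axis: for all $x\ne0$, $$f(x)={\rm Re}\sum_{0\le k\le n-1}\frac{(-2)^kB_k}{k!}\,\log^k|z|\;{\rm Li}_{n-k}(z)\Big|_{z=e^x},$$ so the right-hand side extends smoothly across $z=1$. 2. For every $n\ge1$ there is a real-valued $g\in C^\infty(\mathbb R)$ such that $\lambda i_n$ is given (in the same sense) by the function $$-(-2)^{n-1}B^{n-1}(-\tfrac12)\,\frac{x^{n-1}}{(n-1)!}\log|x|+g(x).$$ 3. As formal power series, $\sum_{m\ge0}B^m(-\tfrac12)\,t^m/m!=\dfrac{t}{2\sinh(t/2)}$, and $B^m(-\tfrac12)=0$ for every odd $m$; in particular the coefficient in 2 vanishes when $n$ is even. -/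

import Mathlib

open MeasureTheory Set Filter Topology SchwartzMap
open scoped ContDiff

noncomputable section
namespace Polylog

/-- The half-line integral `∫₀^∞ x^(w-1) g(x + t) dx`; for `Re w > 0` and rapidly decreasing `g` it is
`Γ(w)` times the pairing of `γ₊^w(x) = x₊^(w-1) / Γ(w)` with `x ↦ g(x + t)`. -/
def halfLineIntegral (w : ℂ) (g : ℝ → ℂ) (t : ℝ) : ℂ :=
  ∫ x in Ioi (0 : ℝ), (x : ℂ) ^ (w - 1) * g (x + t)

theorem integrableOn_inv_one_add_sq :
    IntegrableOn (fun x : ℝ => (1 + x ^ 2)⁻¹) (Ioi 0) :=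
  integrable_inv_one_add_sq.integrableOn

theorem norm_cpow_le {w : ℂ} {M : ℕ} (h1 : 1 ≤ w.re) (hM : w.re - 1 ≤ M) {x : ℝ} (hx : 0 < x) :
    ‖(x : ℂ) ^ (w - 1)‖ ≤ (1 + x) ^ M := by
  rw [Complex.norm_cpow_eq_rpow_re_of_pos hx, Complex.sub_re, Complex.one_re,
    ← Real.rpow_natCast]
  calc x ^ (w.re - 1) ≤ (1 + x) ^ (w.re - 1) :=
        Real.rpow_le_rpow hx.le (by linarith) (by linarith)
    _ ≤ (1 + x) ^ (M : ℝ) := Real.rpow_le_rpow_of_exponent_le (by linarith) hM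

theorem peetre {N : ℕ} {A : ℝ} {u : ℝ} (hu : (0:ℝ) ≤ u) {x y t : ℝ} (hx : 0 < x) (ht : 0 ≤ t)
    (hy : |x - y| ≤ t) (h : (1 + |y|) ^ N * u ≤ A) :
    (1 + x) ^ N * u ≤ A * (1 + t) ^ N := by
  have h0 : 1 + x ≤ (1 + |y|) * (1 + t) := by
    have : x ≤ |y| + t := by linarith [le_abs_self y, le_abs_self (x - y)]
    nlinarith [abs_nonneg y, mul_nonneg (abs_nonneg y) ht]
  calc (1 + x) ^ N * u ≤ ((1 + |y|) * (1 + t)) ^ N * u := by gcongr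
    _ = ((1 + |y|) ^ N * u) * (1 + t) ^ N := by rw [mul_pow]; ring
    _ ≤ _ := by gcongr

theorem weight_bound {M : ℕ} {x a u B : ℝ} (hx : 0 < x) (hu : 0 ≤ u)
    (hau : a ≤ (1 + x) ^ M) (h : (1 + x) ^ (M + 2) * u ≤ B) :
    a * u ≤ B * (1 + x ^ 2)⁻¹ := by
  rw [← div_eq_mul_inv, le_div_iff₀ (by positivity)]
  calc a * u * (1 + x ^ 2) ≤ (1 + x) ^ M * u * (1 + x) ^ 2 := by
        gcongr; nlinarith
    _ = (1 + x) ^ (M + 2) * u := by ring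
    _ ≤ B := h

section bounds

variable {w : ℂ} {M : ℕ} {A : ℝ} {g : ℝ → ℂ}

theorem integrand_bound (h1 : 1 ≤ w.re) (hM : w.re - 1 ≤ M)
    (hA : ∀ y, (1 + |y|) ^ (M + 4) * ‖g y‖ ≤ A) (t : ℝ) {x : ℝ} (hx : 0 < x) :
    ‖(x : ℂ) ^ (w - 1) * g (x + t)‖ ≤ A * (1 + |t|) ^ (M + 4) * (1 + x ^ 2)⁻¹ := by
  rw [norm_mul]
  refine weight_bound hx (norm_nonneg _) (norm_cpow_le h1 hM hx) ?_
  refine le_trans ?_ (peetre (norm_nonneg _) hx (abs_nonneg t) (by simp) (hA (x + t)))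
  gcongr <;> linarith

theorem integrable_integrand (h1 : 1 ≤ w.re) (hM : w.re - 1 ≤ M) (hg : Continuous g)
    (hA : ∀ y, (1 + |y|) ^ (M + 4) * ‖g y‖ ≤ A) (t : ℝ) :
    IntegrableOn (fun x : ℝ => (x : ℂ) ^ (w - 1) * g (x + t)) (Ioi 0) := by
  refine Integrable.mono' (integrableOn_inv_one_add_sq.const_mul (A * (1 + |t|) ^ (M + 4)))
    (Measurable.aestronglyMeasurable ?_) ?_
  · exact (by fun_prop : Measurable fun x : ℝ => (x : ℂ) ^ (w - 1)).mul
      (hg.measurable.comp (measurable_id.add_const t))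
  · exact (ae_restrict_mem measurableSet_Ioi).mono fun x hx => integrand_bound h1 hM hA t hx

theorem measurable_halfLineIntegral (hg : Continuous g) : Measurable (halfLineIntegral w g) := by
  have : Measurable fun p : ℝ × ℝ => (p.2 : ℂ) ^ (w - 1) * g (p.2 + p.1) :=
    (by fun_prop : Measurable fun p : ℝ × ℝ => (p.2 : ℂ) ^ (w - 1)).mul
      (hg.measurable.comp (by fun_prop))
  exact (this.stronglyMeasurable.integral_prod_right (ν := volume.restrict (Ioi 0))).measurable

/-- The constant `∫₀^∞ dx / (1 + x²)`, used only in estimates. -/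
def arctanMass : ℝ := ∫ x in Ioi (0 : ℝ), (1 + x ^ 2)⁻¹

theorem arctanMass_nonneg : 0 ≤ arctanMass :=
  setIntegral_nonneg measurableSet_Ioi fun x _ => by positivity

theorem norm_integral_le_arctanMass {f : ℝ → ℂ} {B : ℝ}
    (h : ∀ x, 0 < x → ‖f x‖ ≤ B * (1 + x ^ 2)⁻¹) :
    ‖∫ x in Ioi (0 : ℝ), f x‖ ≤ B * arctanMass := by
  rw [arctanMass, ← integral_const_mul]
  exact norm_integral_le_of_norm_le (integrableOn_inv_one_add_sq.const_mul B)
    ((ae_restrict_mem measurableSet_Ioi).mono fun x hx => h x hx)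

theorem norm_halfLineIntegral_le (h1 : 1 ≤ w.re) (hM : w.re - 1 ≤ M)
    (hA : ∀ y, (1 + |y|) ^ (M + 4) * ‖g y‖ ≤ A) (t : ℝ) :
    ‖halfLineIntegral w g t‖ ≤ A * (1 + |t|) ^ (M + 4) * arctanMass :=
  norm_integral_le_arctanMass fun _ hx => integrand_bound h1 hM hA t hx

theorem norm_halfLineIntegral_le_of_pos (h1 : 1 ≤ w.re) (hM : w.re - 1 ≤ M)
    (hA : ∀ y, (1 + |y|) ^ (M + 4) * ‖g y‖ ≤ A) {t : ℝ} (ht : 0 ≤ t) :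
    ‖halfLineIntegral w g t‖ ≤ A * arctanMass * (1 + t ^ 2)⁻¹ := by
  have hA' : A * (1 + t ^ 2)⁻¹ * arctanMass = A * arctanMass * (1 + t ^ 2)⁻¹ := by ring
  rw [← hA']
  refine norm_integral_le_arctanMass fun x hx => ?_
  rw [norm_mul]
  refine weight_bound hx (norm_nonneg _) (norm_cpow_le h1 hM hx) ?_
  rw [← div_eq_mul_inv, le_div_iff₀ (by positivity)]
  have h2 := hA (x + t)
  rw [abs_of_nonneg (by positivity)] at h2
  calc (1 + x) ^ (M + 2) * ‖g (x + t)‖ * (1 + t ^ 2)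
      ≤ (1 + (x + t)) ^ (M + 2) * ‖g (x + t)‖ * (1 + (x + t)) ^ 2 := by
        gcongr <;> nlinarith
    _ = (1 + (x + t)) ^ (M + 4) * ‖g (x + t)‖ := by ring
    _ ≤ A := h2

theorem norm_halfLineIntegral_sub_le (h1 : 1 ≤ w.re) (hM : w.re - 1 ≤ M)
    (hd : Differentiable ℝ g)
    (hA : ∀ y, (1 + |y|) ^ (M + 4) * ‖g y‖ ≤ A)
    (hA' : ∀ y, (1 + |y|) ^ (M + 4) * ‖deriv g y‖ ≤ A) {t : ℝ} (ht : 0 < t) :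
    ‖halfLineIntegral w g (-t) - halfLineIntegral w g t‖ ≤
      2 * t * (A * arctanMass * (1 + t) ^ (M + 4)) := by
  have e : 2 * t * (A * arctanMass * (1 + t) ^ (M + 4)) =
      (2 * t * (A * (1 + t) ^ (M + 4))) * arctanMass := by ring
  rw [e, halfLineIntegral, halfLineIntegral,
    ← integral_sub (integrable_integrand h1 hM hd.continuous hA _)
      (integrable_integrand h1 hM hd.continuous hA _)]
  refine norm_integral_le_arctanMass fun x hx => ?_
  rw [← mul_sub, norm_mul]
  refine weight_bound hx (norm_nonneg _) (norm_cpow_le h1 hM hx) ?_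
  set D := A * (1 + t) ^ (M + 4) / (1 + x) ^ (M + 4) with hD
  have key : ‖g (x + -t) - g (x + t)‖ ≤ D * (2 * t) := by
    have := (convex_Icc (x + -t) (x + t)).norm_image_sub_le_of_norm_deriv_le (𝕜 := ℝ) (f := g)
      (C := D) (fun y _ => hd y) ?_ (right_mem_Icc.2 (by linarith)) (left_mem_Icc.2 (by linarith))
    · have e2 : ‖x + -t - (x + t)‖ = 2 * t := by
        rw [show x + -t - (x + t) = -(2 * t) by ring, norm_neg, Real.norm_of_nonneg (by linarith)]
      rwa [e2] at this
    · intro y hy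
      rw [hD, le_div_iff₀ (by positivity), mul_comm]
      refine peetre (norm_nonneg _) hx ht.le ?_ (hA' y)
      rw [abs_le]; constructor <;> linarith [hy.1, hy.2]
  calc (1 + x) ^ (M + 2) * ‖g (x + -t) - g (x + t)‖
      ≤ (1 + x) ^ (M + 4) * (D * (2 * t)) := by
        gcongr <;> linarith
    _ = _ := by rw [hD]; field_simp

theorem exp_weight (N : ℕ) {t : ℝ} (ht : 0 < t) :
    t * (1 + t) ^ N / (Real.exp t - 1) ≤
      Real.exp (1 / 2) * 2 ^ (N + 2) * (N + 2).factorial * (1 + t ^ 2)⁻¹ := by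
  have hs : t * Real.exp (t / 2) ≤ Real.exp t - 1 := by
    have h := Real.self_le_sinh_iff.2 (by positivity : 0 ≤ t / 2)
    rw [Real.sinh_eq] at h
    have h1 : Real.exp t = Real.exp (t / 2) * Real.exp (t / 2) := by
      rw [← Real.exp_add]; ring_nf
    have h2 : Real.exp (t / 2) * Real.exp (-(t / 2)) = 1 := by
      rw [← Real.exp_add]; simp
    nlinarith [Real.exp_pos (t / 2)]
  have hpos : 0 < Real.exp t - 1 := lt_of_lt_of_le (by positivity) hs
  have hp := Real.pow_div_factorial_le_exp ((1 + t) / 2) (by positivity) (N + 2)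
  have hp' : (1 + t) ^ (N + 2) ≤ Real.exp (1 / 2) * 2 ^ (N + 2) * (N + 2).factorial * Real.exp (t / 2) := by
    rw [div_pow, div_div, div_le_iff₀ (by positivity), show (1 + t) / 2 = 1 / 2 + t / 2 by ring,
      Real.exp_add] at hp
    linarith
  rw [← div_eq_mul_inv, div_le_div_iff₀ hpos (by positivity)]
  calc t * (1 + t) ^ N * (1 + t ^ 2) ≤ t * (1 + t) ^ N * (1 + t) ^ 2 := by
        gcongr; nlinarith
    _ = t * (1 + t) ^ (N + 2) := by ring
    _ ≤ t * (Real.exp (1 / 2) * 2 ^ (N + 2) * (N + 2).factorial * Real.exp (t / 2)) := by gcongr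
    _ = Real.exp (1 / 2) * 2 ^ (N + 2) * (N + 2).factorial * (t * Real.exp (t / 2)) := by ring
    _ ≤ _ := by gcongr

end bounds

/-- The function `li₀(t) = 1 / (e^(-t) - 1)` on `t ≠ 0`. -/
def polylogZero (t : ℝ) : ℝ := 1 / (Real.exp (-t) - 1)

/-- The Cauchy principal value at the origin, `lim_{ε → 0+} ∫_{|t| > ε} h(t) dt`. -/
def principalValue (h : ℝ → ℂ) : ℂ :=
  limUnder (𝓝[>] (0 : ℝ)) fun ε => ∫ t in {t : ℝ | ε < |t|}, h t

/-- For `t > 0` this is `li₀(t) F(t) + li₀(-t) F(-t)`, the integrand of the principal value of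
`li₀ F` folded onto the positive half-line. -/
def symmetrized (F : ℝ → ℂ) (t : ℝ) : ℂ :=
  (F (-t) - F t) / ((Real.exp t - 1 : ℝ) : ℂ) - F t

section principal

variable {F : ℝ → ℂ} {N : ℕ} {B : ℝ}

/-- A constant used only in estimates. -/
def symmConst (N : ℕ) : ℝ := 2 * (Real.exp (1 / 2) * 2 ^ (N + 2) * (N + 2).factorial) + 1

theorem norm_symmetrized_le (hB : 0 ≤ B)
    (h2 : ∀ t, 0 ≤ t → ‖F t‖ ≤ B * (1 + t ^ 2)⁻¹)
    (h3 : ∀ t, 0 < t → ‖F (-t) - F t‖ ≤ 2 * t * (B * (1 + t) ^ N)) {t : ℝ} (ht : 0 < t) :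
    ‖symmetrized F t‖ ≤ B * symmConst N * (1 + t ^ 2)⁻¹ := by
  have hpos : 0 < Real.exp t - 1 := by linarith [Real.add_one_lt_exp ht.ne']
  have ha : ‖(F (-t) - F t) / ((Real.exp t - 1 : ℝ) : ℂ)‖ ≤
      2 * B * (Real.exp (1 / 2) * 2 ^ (N + 2) * (N + 2).factorial * (1 + t ^ 2)⁻¹) := by
    rw [norm_div, Complex.norm_real, Real.norm_of_nonneg hpos.le]
    calc ‖F (-t) - F t‖ / (Real.exp t - 1) ≤ 2 * t * (B * (1 + t) ^ N) / (Real.exp t - 1) := by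
          gcongr; exact h3 t ht
      _ = 2 * B * (t * (1 + t) ^ N / (Real.exp t - 1)) := by ring
      _ ≤ _ := by gcongr; exact exp_weight N ht
  calc ‖symmetrized F t‖ ≤ _ + _ := norm_sub_le _ _
    _ ≤ _ := add_le_add ha (h2 t ht.le)
    _ = _ := by rw [symmConst]; ring

theorem measurable_symmetrized (hF : Measurable F) : Measurable (symmetrized F) := by
  unfold symmetrized
  have : Measurable fun t => F (-t) := hF.comp measurable_neg
  fun_prop

theorem integrableOn_symmetrized (hF : Measurable F) (hB : 0 ≤ B)
    (h2 : ∀ t, 0 ≤ t → ‖F t‖ ≤ B * (1 + t ^ 2)⁻¹)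
    (h3 : ∀ t, 0 < t → ‖F (-t) - F t‖ ≤ 2 * t * (B * (1 + t) ^ N)) :
    IntegrableOn (symmetrized F) (Ioi 0) :=
  Integrable.mono' (integrableOn_inv_one_add_sq.const_mul (B * symmConst N))
    (measurable_symmetrized hF).aestronglyMeasurable
    ((ae_restrict_mem measurableSet_Ioi).mono fun _ hx => norm_symmetrized_le hB h2 h3 hx)

theorem setIntegral_punctured (hF : Measurable F) (hB : 0 ≤ B)
    (h1 : ∀ t, ‖F t‖ ≤ B * (1 + |t|) ^ N)
    (h2 : ∀ t, 0 ≤ t → ‖F t‖ ≤ B * (1 + t ^ 2)⁻¹) {ε : ℝ} (hε : 0 < ε) :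
    ∫ t in {t : ℝ | ε < |t|}, (polylogZero t : ℂ) * F t = ∫ t in Ioi ε, symmetrized F t := by
  have hset : {t : ℝ | ε < |t|} = Iio (-ε) ∪ Ioi ε := by
    ext t; simp only [mem_ofPred_eq, lt_abs, mem_union, mem_Iio, mem_Ioi]
    constructor
    · rintro (h | h)
      · exact Or.inr h
      · exact Or.inl (by linarith)
    · rintro (h | h)
      · exact Or.inr (by linarith)
      · exact Or.inl h
  have hker : Measurable fun t : ℝ => (polylogZero t : ℂ) := by
    unfold polylogZero; fun_prop
  have hmeas : Measurable fun t : ℝ => (polylogZero t : ℂ) * F t := hker.mul hF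
  have hFn : Measurable fun t => F (-t) := hF.comp measurable_neg
  have hpos : IntegrableOn (fun t : ℝ => (polylogZero t : ℂ) * F t) (Ioi ε) := by
    refine Integrable.mono' ((integrableOn_inv_one_add_sq.mono_set
      (Ioi_subset_Ioi hε.le)).const_mul (1 / (1 - Real.exp (-ε)) * B))
      hmeas.aestronglyMeasurable ((ae_restrict_mem measurableSet_Ioi).mono fun t ht => ?_)
    have ht' : ε < t := ht
    have he : Real.exp (-t) ≤ Real.exp (-ε) := Real.exp_le_exp.2 (by linarith)
    have he1 : Real.exp (-ε) < 1 := (by rw [← Real.exp_zero]; exact Real.exp_lt_exp.2 (by linarith))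
    rw [norm_mul, Complex.norm_real, polylogZero, norm_div, norm_one,
      Real.norm_of_nonpos (by linarith), mul_assoc]
    have h1e : 0 < 1 - Real.exp (-ε) := by linarith
    gcongr
    · linarith
    · exact h2 t (by linarith)
  have hneg' : IntegrableOn (fun t : ℝ => (polylogZero (-t) : ℂ) * F (-t)) (Ioi ε) := by
    refine Integrable.mono' ((integrableOn_inv_one_add_sq.mono_set
      (Ioi_subset_Ioi hε.le)).const_mul
        (B / ε * (Real.exp (1 / 2) * 2 ^ (N + 2) * (N + 2).factorial)))
      (hmeas.comp measurable_neg).aestronglyMeasurable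
      ((ae_restrict_mem measurableSet_Ioi).mono fun t ht => ?_)
    have ht' : ε < t := ht
    have ht0 : 0 < t := hε.trans ht'
    have hp : 0 < Real.exp t - 1 := by linarith [Real.add_one_lt_exp ht0.ne']
    have h1t := h1 (-t)
    rw [abs_neg, abs_of_pos ht0] at h1t
    rw [norm_mul, Complex.norm_real, polylogZero, norm_div, norm_one, neg_neg,
      Real.norm_of_nonneg hp.le]
    calc 1 / (Real.exp t - 1) * ‖F (-t)‖ ≤ 1 / (Real.exp t - 1) * (B * (1 + t) ^ N * (t / ε)) := by
          gcongr
          refine h1t.trans (le_mul_of_one_le_right (by positivity) ?_)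
          rw [le_div_iff₀ hε]; linarith
      _ = B / ε * (t * (1 + t) ^ N / (Real.exp t - 1)) := by ring
      _ ≤ B / ε * (Real.exp (1 / 2) * 2 ^ (N + 2) * (N + 2).factorial * (1 + t ^ 2)⁻¹) := by
          gcongr; exact exp_weight N ht0
      _ = _ := by ring
  have hneg : IntegrableOn (fun t : ℝ => (polylogZero t : ℂ) * F t) (Iio (-ε)) := by
    have h := ((Measure.measurePreserving_neg (volume : Measure ℝ)).integrableOn_comp_preimage
      (Homeomorph.neg ℝ).measurableEmbedding (s := Iio (-ε))
      (f := fun t : ℝ => (polylogZero t : ℂ) * F t)).1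
    refine h ?_
    have hpre : (Neg.neg ⁻¹' Iio (-ε) : Set ℝ) = Ioi ε := by ext; simp
    rw [hpre]
    exact hneg'
  rw [hset, setIntegral_union (by
      rw [Set.disjoint_left]; intro t h h'
      simp only [mem_Iio, mem_Ioi] at h h'; linarith) measurableSet_Ioi hneg hpos]
  have hflip : ∫ t in Iio (-ε), (polylogZero t : ℂ) * F t =
      ∫ t in Ioi ε, (polylogZero (-t) : ℂ) * F (-t) := by
    rw [← integral_Iic_eq_integral_Iio,
      integral_comp_neg_Ioi ε fun t => (polylogZero t : ℂ) * F t]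
  rw [hflip, ← integral_add hneg' hpos]
  refine setIntegral_congr_fun measurableSet_Ioi fun t ht => ?_
  have ht0 : 0 < t := hε.trans ht
  have hp : Real.exp t - 1 ≠ 0 := by linarith [Real.add_one_lt_exp ht0.ne']
  have hk : polylogZero t = -1 - 1 / (Real.exp t - 1) := by
    have h0 := (Real.exp_pos t).ne'
    have hq : 1 - Real.exp t ≠ 0 := by intro h; apply hp; linarith
    rw [polylogZero, Real.exp_neg, inv_eq_one_div, div_sub_one h0]
    field_simp
    ring
  have hk' : polylogZero (-t) = 1 / (Real.exp t - 1) := by rw [polylogZero, neg_neg]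
  simp only [symmetrized, hk, hk']
  push_cast
  ring

theorem tendsto_principalValue (hF : Measurable F) (hB : 0 ≤ B)
    (h1 : ∀ t, ‖F t‖ ≤ B * (1 + |t|) ^ N)
    (h2 : ∀ t, 0 ≤ t → ‖F t‖ ≤ B * (1 + t ^ 2)⁻¹)
    (h3 : ∀ t, 0 < t → ‖F (-t) - F t‖ ≤ 2 * t * (B * (1 + t) ^ N)) :
    Tendsto (fun ε => ∫ t in {t : ℝ | ε < |t|}, (polylogZero t : ℂ) * F t) (𝓝[>] (0 : ℝ))
      (𝓝 (∫ t in Ioi (0 : ℝ), symmetrized F t)) := by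
  have hc := ((integrableOn_symmetrized hF hB h2 h3).continuousWithinAt_Ici_primitive_Ioi).mono
    Ioi_subset_Ici_self
  refine Tendsto.congr' ?_ hc.tendsto
  filter_upwards [self_mem_nhdsWithin] with ε hε
  exact (setIntegral_punctured hF hB h1 h2 hε).symm

end principal

/-- A number `k` of integrations by parts with `Re (s + k) ≥ 1`; it is `0` when `Re s ≥ 1`. -/
def gammaOrder (s : ℂ) : ℕ := ⌈1 - s.re⌉₊

/-- `F_s(t) = ⟨γ₊^s, φ(· + t)⟩`, where `γ₊^s(x) = x₊^(s-1) / Γ(s)` is the entire family of tempered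
distributions, i.e. `(-1)^k / Γ(s + k) ∫₀^∞ x^(s+k-1) φ^(k)(x + t) dx` for any `k` with
`Re (s + k) > 0` (the value does not depend on `k`). For `Re s ≥ 1` the choice made here is `k = 0`,
the absolutely convergent integral `1 / Γ(s) ∫₀^∞ x^(s-1) φ(x + t) dx`. -/
def gammaPairing (s : ℂ) (φ : 𝓢(ℝ, ℂ)) (t : ℝ) : ℂ :=
  (-1) ^ gammaOrder s / Complex.Gamma (s + gammaOrder s) *
    halfLineIntegral (s + gammaOrder s) (iteratedDeriv (gammaOrder s) φ) t

/-- `⟨γ₊^s * li₀, φ⟩ = PV ∫ F_s(t) / (e^(-t) - 1) dt`. -/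
def polylogPairing (s : ℂ) (φ : 𝓢(ℝ, ℂ)) : ℂ :=
  principalValue fun t => (polylogZero t : ℂ) * gammaPairing s φ t

theorem one_le_re_add_gammaOrder (s : ℂ) : 1 ≤ (s + gammaOrder s).re := by
  have := Nat.le_ceil (1 - s.re)
  simp only [Complex.add_re, Complex.natCast_re, gammaOrder]
  linarith

/-- A growth exponent used only in estimates. -/
def growthOrder (s : ℂ) : ℕ := ⌈(s + gammaOrder s).re - 1⌉₊

/-- A Schwartz seminorm used only in estimates. -/
def schwartzNorm (s : ℂ) (φ : 𝓢(ℝ, ℂ)) : ℝ :=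
  (Finset.Iic (growthOrder s + 4, gammaOrder s + 1)).sup (schwartzSeminormFamily ℂ ℝ ℂ) φ

theorem iteratedDeriv_bound (s : ℂ) (φ : 𝓢(ℝ, ℂ)) {j : ℕ} (hj : j ≤ gammaOrder s + 1) (y : ℝ) :
    (1 + |y|) ^ (growthOrder s + 4) * ‖iteratedDeriv j φ y‖ ≤
      2 ^ (growthOrder s + 4) * schwartzNorm s φ := by
  have := SchwartzMap.one_add_le_sup_seminorm_apply (𝕜 := ℂ)
    (m := (growthOrder s + 4, gammaOrder s + 1)) le_rfl hj φ y
  rwa [norm_iteratedFDeriv_eq_norm_iteratedDeriv, Real.norm_eq_abs] at this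

theorem differentiable_iteratedDeriv_schwartz (φ : 𝓢(ℝ, ℂ)) (k : ℕ) :
    Differentiable ℝ (iteratedDeriv k φ) :=
  (φ.smooth (k + 1 : ℕ)).differentiable_iteratedDeriv k (by exact_mod_cast Nat.lt_succ_self k)

theorem measurable_gammaPairing (s : ℂ) (φ : 𝓢(ℝ, ℂ)) : Measurable (gammaPairing s φ) :=
  (measurable_halfLineIntegral (differentiable_iteratedDeriv_schwartz φ _).continuous).const_mul _

/-- A constant used only in estimates. -/
def boundConst (s : ℂ) : ℝ :=
  ‖(-1) ^ gammaOrder s / Complex.Gamma (s + gammaOrder s)‖ *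
    (2 ^ (growthOrder s + 4) * arctanMass)

theorem boundConst_nonneg (s : ℂ) : 0 ≤ boundConst s :=
  mul_nonneg (norm_nonneg _) (mul_nonneg (by positivity) arctanMass_nonneg)

theorem schwartzNorm_nonneg (s : ℂ) (φ : 𝓢(ℝ, ℂ)) : 0 ≤ schwartzNorm s φ := apply_nonneg _ _

theorem norm_gammaPairing_le (s : ℂ) (φ : 𝓢(ℝ, ℂ)) (t : ℝ) :
    ‖gammaPairing s φ t‖ ≤ boundConst s * schwartzNorm s φ * (1 + |t|) ^ (growthOrder s + 4) := by
  rw [gammaPairing, norm_mul]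
  refine (mul_le_mul_of_nonneg_left (norm_halfLineIntegral_le (one_le_re_add_gammaOrder s)
    (Nat.le_ceil _) (iteratedDeriv_bound s φ (Nat.le_succ _)) t) (norm_nonneg _)).trans_eq ?_
  rw [boundConst, growthOrder]; ring

theorem norm_gammaPairing_le_of_nonneg (s : ℂ) (φ : 𝓢(ℝ, ℂ)) (t : ℝ) (ht : 0 ≤ t) :
    ‖gammaPairing s φ t‖ ≤ boundConst s * schwartzNorm s φ * (1 + t ^ 2)⁻¹ := by
  rw [gammaPairing, norm_mul]
  refine (mul_le_mul_of_nonneg_left (norm_halfLineIntegral_le_of_pos (one_le_re_add_gammaOrder s)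
    (Nat.le_ceil _) (iteratedDeriv_bound s φ (Nat.le_succ _)) ht) (norm_nonneg _)).trans_eq ?_
  rw [boundConst]; ring

theorem norm_gammaPairing_sub_le (s : ℂ) (φ : 𝓢(ℝ, ℂ)) (t : ℝ) (ht : 0 < t) :
    ‖gammaPairing s φ (-t) - gammaPairing s φ t‖ ≤
      2 * t * (boundConst s * schwartzNorm s φ * (1 + t) ^ (growthOrder s + 4)) := by
  rw [gammaPairing, gammaPairing, ← mul_sub, norm_mul]
  refine (mul_le_mul_of_nonneg_left (norm_halfLineIntegral_sub_le (one_le_re_add_gammaOrder s)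
    (Nat.le_ceil _) (differentiable_iteratedDeriv_schwartz φ _)
    (iteratedDeriv_bound s φ (Nat.le_succ _)) (fun y => ?_) ht) (norm_nonneg _)).trans_eq ?_
  · rw [← iteratedDeriv_succ]
    exact iteratedDeriv_bound s φ le_rfl y
  · rw [boundConst, growthOrder]; ring

/-- The limit defining the principal value in `polylogPairing` exists. -/
theorem tendsto_polylogPairing (s : ℂ) (φ : 𝓢(ℝ, ℂ)) :
    Tendsto (fun ε => ∫ t in {t : ℝ | ε < |t|}, (polylogZero t : ℂ) * gammaPairing s φ t)
      (𝓝[>] (0 : ℝ)) (𝓝 (∫ t in Ioi (0 : ℝ), symmetrized (gammaPairing s φ) t)) :=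
  tendsto_principalValue (measurable_gammaPairing s φ)
    (mul_nonneg (boundConst_nonneg s) (schwartzNorm_nonneg s φ)) (norm_gammaPairing_le s φ)
    (norm_gammaPairing_le_of_nonneg s φ) (norm_gammaPairing_sub_le s φ)

theorem polylogPairing_eq (s : ℂ) (φ : 𝓢(ℝ, ℂ)) :
    polylogPairing s φ = ∫ t in Ioi (0 : ℝ), symmetrized (gammaPairing s φ) t :=
  (tendsto_polylogPairing s φ).limUnder_eq

theorem integrableOn_symmetrized_gammaPairing (s : ℂ) (φ : 𝓢(ℝ, ℂ)) :
    IntegrableOn (symmetrized (gammaPairing s φ)) (Ioi 0) :=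
  integrableOn_symmetrized (measurable_gammaPairing s φ)
    (mul_nonneg (boundConst_nonneg s) (schwartzNorm_nonneg s φ))
    (norm_gammaPairing_le_of_nonneg s φ) (norm_gammaPairing_sub_le s φ)

theorem gammaPairing_add (s : ℂ) (φ ψ : 𝓢(ℝ, ℂ)) (t : ℝ) :
    gammaPairing s (φ + ψ) t = gammaPairing s φ t + gammaPairing s ψ t := by
  have hd (φ : 𝓢(ℝ, ℂ)) := integrable_integrand (one_le_re_add_gammaOrder s) (Nat.le_ceil _)
    (differentiable_iteratedDeriv_schwartz φ (gammaOrder s)).continuous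
    (iteratedDeriv_bound s φ (Nat.le_succ _)) t
  simp only [gammaPairing, halfLineIntegral]
  rw [← mul_add, ← integral_add (hd φ) (hd ψ)]
  congr 2
  ext x
  have : iteratedDeriv (gammaOrder s) (⇑(φ + ψ)) (x + t) = iteratedDeriv (gammaOrder s) φ (x + t) +
      iteratedDeriv (gammaOrder s) ψ (x + t) := by
    rw [show (⇑(φ + ψ) : ℝ → ℂ) = ⇑φ + ⇑ψ from rfl]
    exact iteratedDeriv_add (φ.smooth (gammaOrder s)).contDiffAt
      (ψ.smooth (gammaOrder s)).contDiffAt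
  rw [this, mul_add]

theorem gammaPairing_smul (s a : ℂ) (φ : 𝓢(ℝ, ℂ)) (t : ℝ) :
    gammaPairing s (a • φ) t = a * gammaPairing s φ t := by
  have h (y : ℝ) : iteratedDeriv (gammaOrder s) (⇑(a • φ)) y =
      a * iteratedDeriv (gammaOrder s) φ y := by
    rw [show (⇑(a • φ) : ℝ → ℂ) = a • ⇑φ from rfl]
    exact iteratedDeriv_const_smul (φ.smooth (gammaOrder s)).contDiffAt a
  simp only [gammaPairing, halfLineIntegral, h, mul_left_comm _ a, integral_const_mul]

theorem polylogPairing_add (s : ℂ) (φ ψ : 𝓢(ℝ, ℂ)) :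
    polylogPairing s (φ + ψ) = polylogPairing s φ + polylogPairing s ψ := by
  rw [polylogPairing_eq, polylogPairing_eq, polylogPairing_eq,
    ← integral_add (integrableOn_symmetrized_gammaPairing s φ)
      (integrableOn_symmetrized_gammaPairing s ψ)]
  congr 1
  ext t
  simp only [symmetrized, gammaPairing_add]
  ring

theorem polylogPairing_smul (s a : ℂ) (φ : 𝓢(ℝ, ℂ)) :
    polylogPairing s (a • φ) = a * polylogPairing s φ := by
  rw [polylogPairing_eq, polylogPairing_eq, ← integral_const_mul]
  congr 1
  ext t
  simp only [symmetrized, gammaPairing_smul]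
  ring

theorem norm_polylogPairing_le (s : ℂ) (φ : 𝓢(ℝ, ℂ)) :
    ‖polylogPairing s φ‖ ≤
      boundConst s * symmConst (growthOrder s + 4) * arctanMass * schwartzNorm s φ := by
  rw [polylogPairing_eq]
  refine (norm_integral_le_arctanMass fun t ht => norm_symmetrized_le
    (mul_nonneg (boundConst_nonneg s) (schwartzNorm_nonneg s φ))
    (norm_gammaPairing_le_of_nonneg s φ) (norm_gammaPairing_sub_le s φ) ht).trans_eq ?_
  ring

/-- The tempered distribution `li_s = γ₊^s * li₀` on the real line, `s ∈ ℂ`. -/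
def polylogDist (s : ℂ) : 𝓢'(ℝ, ℂ) :=
  ContinuousLinearMap.toPointwiseConvergenceCLM _ _ _ _
    (SchwartzMap.mkCLMtoNormedSpace (𝕜 := ℂ) (polylogPairing s) (polylogPairing_add s)
      (polylogPairing_smul s)
      ⟨Finset.Iic (growthOrder s + 4, gammaOrder s + 1),
        boundConst s * symmConst (growthOrder s + 4) * arctanMass,
        mul_nonneg (mul_nonneg (boundConst_nonneg s) (by rw [symmConst]; positivity))
          arctanMass_nonneg,
        norm_polylogPairing_le s⟩)

theorem polylogDist_apply (s : ℂ) (φ : 𝓢(ℝ, ℂ)) : polylogDist s φ = polylogPairing s φ := rfl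

/-- The distribution `λi_n(x) = ∑_{0 ≤ k ≤ n-1} B_k (-2x)^k / k! · li_{n-k}(x)`, with the Bernoulli
numbers normalized by `t / (1 - e^(-t)) = ∑ B_k t^k / k!`, so that `B_1 = 1/2`. -/
def modifiedPolylogDist (n : ℕ) : 𝓢'(ℝ, ℂ) :=
  ∑ k ∈ Finset.range n,
    TemperedDistribution.smulLeftCLM ℂ
      (fun x : ℝ => ((bernoulli' k : ℚ) : ℂ) * (-2 * (x : ℂ)) ^ k / (k.factorial : ℂ))
      (polylogDist ((n - k : ℕ) : ℂ))

/-- The tempered distribution `T` is (integration against) the function `h`. -/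
def IsGivenBy (T : 𝓢'(ℝ, ℂ)) (h : ℝ → ℂ) : Prop :=
  ∀ φ : 𝓢(ℝ, ℂ), Integrable (fun x => h x * φ x) ∧ T φ = ∫ x, h x * φ x

/-- The classical polylogarithm `Li_m(z)`, the continuation of `∑_{j ≥ 1} z^j / j^m` to the plane cut
along `[1, ∞)`, by `Li_1(z) = -log (1 - z)` and
`Li_{m+1}(z) = ∫₀^z Li_m(v) dv / v = ∫₀¹ Li_m(u z) du / u`, the path being the segment from `0` to `z`.
At a point of `(1, ∞)` the value is the boundary value from below; its real part is the same for both
sides of the cut. -/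
def Li : ℕ → ℂ → ℂ
  | 0, z => z / (1 - z)
  | 1, z => -Complex.log (1 - z)
  | m + 2, z => ∫ u in (0 : ℝ)..1, Li (m + 1) ((u : ℂ) * z) / (u : ℂ)

/-- The classical sum `∑_{0 ≤ k ≤ n-1} (-2)^k B_k / k! · log^k |z| · Li_{n-k}(z)`, whose real part (`n`
even) or imaginary part (`n` odd) is the modified polylogarithm. -/
def classicalModifiedSum (n : ℕ) (z : ℂ) : ℂ :=
  ∑ k ∈ Finset.range n,
    (-2 : ℂ) ^ k * ((bernoulli' k : ℚ) : ℂ) / (k.factorial : ℂ) * (Real.log ‖z‖ : ℂ) ^ k *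
      Li (n - k) z

/-- The polynomials `B^m(q)` with `∑ B^m(q) t^m / m! = t e^((q+1)t) / (e^t - 1)`, i.e. the usual Bernoulli
polynomials evaluated at `q + 1`. -/
def bernoulliB (m : ℕ) (q : ℚ) : ℚ := (Polynomial.bernoulli m).eval (q + 1)

end Polylog

end

noncomputable section
namespace Polylog

/-! Seen from the test function, convolution with γ₊^(m+1) is the operator f ↦ ∫_t^∞ f applied m + 1
times (Cauchy's formula for repeated integration, `DecaysRight.integral_sub_pow_mul`). One of these
integrations is absorbed by the principal value: 1/(e^(-t) - 1) has the primitive -log |1 - e^t|,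
whose singularity is integrable, and integration by parts replaces li₀ by this function
(`integral_symmetrized_tailIntegral`). Fubini moves the other m integrations onto the kernel
(`DecaysRight.integral_comp_neg_mul_iterate`). Hence li_{m+1} is a function, the m-fold primitive
`realPolylog m` of -log |1 - e^x|, and the substitution u = e^(x-y) in the recursion for `Li`
identifies it with Re Li_{m+1}(e^x) (`Li_exp_re`).

Since log |1 - e^x| = log |x| + smooth, repeated integration gives `realPolylog m` = -(x^m/m!) log
|x| + smooth (`exists_realPolylog_eq`). In λi_n, with m = n - 1, every term k then contributes the
same singularity x^m log |x|, and the coefficients add up to a binomial convolution of Bernoulli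
numbers, -(-2)^m B_m(1/2)/m! (`sum_modCoeff_mul_pow`). The symmetry B_m(1 - x) = (-1)^m B_m(x) makes
this zero for odd m, so for even n only the smooth remainder is left. -/

/-! ### Bernoulli polynomials at 1/2 -/

theorem bernoulliB_neg_half (m : ℕ) :
    bernoulliB m (-1 / 2) = (Polynomial.bernoulli m).eval (1 / 2) := by
  rw [bernoulliB]; norm_num

/-- The point 1/2 is fixed by x ↦ 1 - x, under which an odd Bernoulli polynomial changes sign. -/
theorem bernoulliB_neg_half_of_odd {m : ℕ} (hm : Odd m) : bernoulliB m (-1 / 2) = 0 := by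
  rw [bernoulliB_neg_half]
  have h := Polynomial.bernoulli_eval_one_sub m (1 / 2)
  rw [hm.neg_one_pow] at h
  norm_num at h
  norm_num
  linarith

theorem sum_choose_mul_bernoulli' (m : ℕ) :
    ∑ k ∈ Finset.range (m + 1), (m.choose k : ℚ) * (-2) ^ k * bernoulli' k =
      (-2) ^ m * bernoulliB m (-1 / 2) := by
  -- By the symmetry at 1/2 the factor (-1)^m changes nothing; it absorbs the signs of (-2)^m and,
  -- termwise, those of `bernoulli'` k = (-1)^k `bernoulli` k.
  have hB : bernoulliB m (-1 / 2) = (-1) ^ m * (Polynomial.bernoulli m).eval (1 / 2) := by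
    rw [bernoulliB_neg_half]
    have h := Polynomial.bernoulli_eval_one_sub m (1 / 2)
    norm_num at h
    norm_num
    exact h
  rw [hB, Polynomial.bernoulli, Polynomial.eval_finsetSum, Finset.mul_sum, Finset.mul_sum]
  refine Finset.sum_congr rfl fun k hk => ?_
  have hk' : k ≤ m := Nat.lt_succ_iff.1 (Finset.mem_range.1 hk)
  obtain ⟨j, rfl⟩ := Nat.exists_eq_add_of_le hk'
  rw [bernoulli'_eq_bernoulli, Polynomial.eval_monomial, Nat.add_sub_cancel_left, pow_add,
    pow_add, show (-2 : ℚ) = (-1) * 2 by norm_num, mul_pow, mul_pow, div_pow, one_pow]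
  have h1 : ((-1 : ℚ) ^ j) * (-1) ^ j = 1 := by rw [← mul_pow]; norm_num
  field_simp
  linear_combination (-((k + j).choose k : ℚ) * bernoulli k) * h1

/-- The division-free form of t/(2 sinh(t/2)): multiply the generating identity at 1/2, Σ · (e^t -
1) = t e^(t/2), by e^(-t/2). -/
theorem bernoulliB_generating_function :
    PowerSeries.mk (fun m : ℕ => bernoulliB m (-1 / 2) / (m.factorial : ℚ)) *
        (PowerSeries.rescale (1 / 2 : ℚ) (PowerSeries.exp ℚ) -
          PowerSeries.rescale (-1 / 2 : ℚ) (PowerSeries.exp ℚ)) = PowerSeries.X := by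
  have h := Polynomial.bernoulli_generating_function (1 / 2 : ℚ)
  have hinv : PowerSeries.rescale (1 / 2 : ℚ) (PowerSeries.exp ℚ) *
      PowerSeries.rescale (-1 / 2 : ℚ) (PowerSeries.exp ℚ) = 1 := by
    rw [PowerSeries.exp_mul_exp_eq_exp_add]; norm_num
  have hsq : PowerSeries.exp ℚ * PowerSeries.rescale (-1 / 2 : ℚ) (PowerSeries.exp ℚ) =
      PowerSeries.rescale (1 / 2 : ℚ) (PowerSeries.exp ℚ) := by
    have := PowerSeries.exp_mul_exp_eq_exp_add (1 : ℚ) (-1 / 2 : ℚ)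
    rw [PowerSeries.rescale_one] at this
    norm_num at this ⊢
    exact this
  have hmk : PowerSeries.mk (fun m : ℕ => bernoulliB m (-1 / 2) / (m.factorial : ℚ)) =
      PowerSeries.mk fun n => Polynomial.aeval (1 / 2 : ℚ)
        ((1 / n.factorial : ℚ) • Polynomial.bernoulli n) := by
    ext m
    simp only [PowerSeries.coeff_mk, map_smul, bernoulliB_neg_half, Polynomial.coe_aeval_eq_eval,
      smul_eq_mul]
    ring
  rw [hmk]
  linear_combination PowerSeries.rescale (-1 / 2 : ℚ) (PowerSeries.exp ℚ) * h +
    PowerSeries.X * hinv - (PowerSeries.mk fun n => Polynomial.aeval (1 / 2 : ℚ)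
        ((1 / n.factorial : ℚ) • Polynomial.bernoulli n)) * hsq

/-! ### Functions decaying at +∞ and their tail primitives -/

section decays

variable {E : Type*} [NormedAddCommGroup E]

/-- Locally integrable functions that grow at most polynomially at `-∞` and decay rapidly at `+∞`. -/
structure DecaysRight (f : ℝ → E) : Prop where
  locallyIntegrable : LocallyIntegrable f
  growth : ∃ (C : ℝ) (N : ℕ), ∀ x ≤ -1, ‖f x‖ ≤ C * (1 + |x|) ^ N
  decay : ∀ N : ℕ, ∃ C : ℝ, ∀ x, 1 ≤ x → ‖f x‖ * (1 + |x|) ^ N ≤ C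

theorem one_add_sq_le_one_add_abs_sq (x : ℝ) : 1 + x ^ 2 ≤ (1 + |x|) ^ 2 := by
  nlinarith [abs_nonneg x, sq_abs x]

theorem le_mul_inv_one_add_sq {a b C x : ℝ} (ha : 0 ≤ a) (h : a * (1 + |x|) ^ 2 ≤ C * b) :
    a ≤ C * b * (1 + x ^ 2)⁻¹ := by
  rw [← div_eq_mul_inv, le_div_iff₀ (by positivity)]
  exact (mul_le_mul_of_nonneg_left (one_add_sq_le_one_add_abs_sq x) ha).trans h

namespace DecaysRight

variable {f : ℝ → E}

theorem aestronglyMeasurable (hf : DecaysRight f) : AEStronglyMeasurable f :=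
  hf.locallyIntegrable.aestronglyMeasurable

theorem mono {F : Type*} [NormedAddCommGroup F] {g : ℝ → F} (hf : DecaysRight f)
    (hg : AEStronglyMeasurable g) (h : ∀ x, ‖g x‖ ≤ ‖f x‖) : DecaysRight g where
  locallyIntegrable := hf.locallyIntegrable.mono hg (ae_of_all _ h)
  growth := by
    obtain ⟨C, N, hC⟩ := hf.growth
    exact ⟨C, N, fun x hx => (h x).trans (hC x hx)⟩
  decay N := by
    obtain ⟨C, hC⟩ := hf.decay N
    exact ⟨C, fun x hx => (mul_le_mul_of_nonneg_right (h x) (by positivity)).trans (hC x hx)⟩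

theorem norm (hf : DecaysRight f) : DecaysRight fun x => ‖f x‖ :=
  hf.mono hf.aestronglyMeasurable.norm fun x => by simp

theorem integrableOn_Ioi (hf : DecaysRight f) (t : ℝ) : IntegrableOn f (Ioi t) := by
  have h1 : IntegrableOn f (Ioi 1) := by
    obtain ⟨C, hC⟩ := hf.decay 2
    refine Integrable.mono' ((integrable_inv_one_add_sq.const_mul (C * 1)).integrableOn)
      hf.aestronglyMeasurable.restrict
      ((ae_restrict_mem measurableSet_Ioi).mono fun x hx => ?_)
    refine le_mul_inv_one_add_sq (norm_nonneg _) ?_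
    rw [mul_one]
    exact hC x (le_of_lt hx)
  refine ((hf.locallyIntegrable.integrableOn_isCompact (isCompact_Icc (a := t) (b := 1))).union
    h1).mono_set fun x hx => ?_
  rcases le_or_gt x 1 with h | h
  · exact Or.inl ⟨le_of_lt hx, h⟩
  · exact Or.inr h

theorem intervalIntegrable (hf : DecaysRight f) (a b : ℝ) : IntervalIntegrable f volume a b :=
  (hf.locallyIntegrable.integrableOn_isCompact isCompact_uIcc).intervalIntegrable

theorem tendsto_zero (hf : DecaysRight f) : Tendsto f atTop (𝓝 0) := by
  obtain ⟨C, hC⟩ := hf.decay 1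
  refine squeeze_zero_norm' (a := fun x : ℝ => C / x) ?_ (tendsto_const_nhds.div_atTop tendsto_id)
  filter_upwards [eventually_ge_atTop 1] with x hx
  rw [le_div_iff₀ (by linarith)]
  refine le_trans ?_ (hC x hx)
  rw [pow_one]
  gcongr
  linarith [le_abs_self x]

theorem mul_left {f : ℝ → ℂ} (hf : DecaysRight f) {p : ℝ → ℂ} (hp : Continuous p) {A : ℝ} {k : ℕ}
    (hA : ∀ x, ‖p x‖ ≤ A * (1 + |x|) ^ k) : DecaysRight fun x => p x * f x where
  locallyIntegrable := hf.locallyIntegrable.continuous_mul hp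
  growth := by
    obtain ⟨C, N, hC⟩ := hf.growth
    refine ⟨A * C, k + N, fun x hx => ?_⟩
    rw [norm_mul, pow_add]
    calc ‖p x‖ * ‖f x‖ ≤ (A * (1 + |x|) ^ k) * (C * (1 + |x|) ^ N) :=
          mul_le_mul (hA x) (hC x hx) (norm_nonneg _) ((norm_nonneg _).trans (hA x))
      _ = _ := by ring
  decay N := by
    obtain ⟨C, hC⟩ := hf.decay (k + N)
    have hA0 : 0 ≤ A := by simpa using (norm_nonneg _).trans (hA 0)
    refine ⟨A * C, fun x hx => ?_⟩
    rw [norm_mul]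
    calc ‖p x‖ * ‖f x‖ * (1 + |x|) ^ N ≤ (A * (1 + |x|) ^ k) * ‖f x‖ * (1 + |x|) ^ N := by
          gcongr
          exact hA x
      _ = A * (‖f x‖ * (1 + |x|) ^ (k + N)) := by ring
      _ ≤ A * C := by gcongr; exact hC x hx

theorem sub_pow_mul {f : ℝ → ℂ} (hf : DecaysRight f) (t : ℝ) (k : ℕ) :
    DecaysRight fun x => ((x : ℂ) - t) ^ k * f x := by
  refine hf.mul_left (by fun_prop) (A := (1 + |t|) ^ k) (k := k) fun x => ?_
  rw [norm_pow, ← mul_pow, ← Complex.ofReal_sub, Complex.norm_real, Real.norm_eq_abs]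
  gcongr
  nlinarith [abs_sub x t, abs_nonneg x, abs_nonneg t]

end DecaysRight

variable [NormedSpace ℝ E]

/-- The primitive `t ↦ ∫_t^∞ f`. -/
def tailIntegral (f : ℝ → E) (t : ℝ) : E := ∫ x in Ioi t, f x

namespace DecaysRight

variable {f : ℝ → E}

theorem tailIntegral_eq (hf : DecaysRight f) (a t : ℝ) :
    tailIntegral f t = tailIntegral f a - ∫ x in a..t, f x := by
  rw [eq_sub_iff_add_eq, add_comm]
  exact intervalIntegral.integral_interval_add_Ioi (hf.integrableOn_Ioi a) (hf.integrableOn_Ioi t)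

theorem continuous_tailIntegral (hf : DecaysRight f) : Continuous (tailIntegral f) := by
  have : tailIntegral f = fun t => tailIntegral f 0 - ∫ x in (0 : ℝ)..t, f x :=
    funext fun t => hf.tailIntegral_eq 0 t
  rw [this]
  exact continuous_const.sub (intervalIntegral.continuous_primitive hf.intervalIntegrable 0)

theorem hasDerivAt_tailIntegral [CompleteSpace E] (hf : DecaysRight f) {t : ℝ}
    (h : ContinuousAt f t) : HasDerivAt (tailIntegral f) (-f t) t := by
  have : tailIntegral f = fun t => tailIntegral f 0 - ∫ x in (0 : ℝ)..t, f x :=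
    funext fun t => hf.tailIntegral_eq 0 t
  rw [this]
  exact (intervalIntegral.integral_hasDerivAt_right (hf.intervalIntegrable 0 t)
    ⟨univ, univ_mem, hf.aestronglyMeasurable.restrict⟩ h).const_sub _

/-- Stability of the class is what allows iteration: integrating raises the growth order at -∞ by
one, and rapid decay at +∞ persists. -/
theorem decaysRight_tailIntegral (hf : DecaysRight f) : DecaysRight (tailIntegral f) where
  locallyIntegrable := hf.continuous_tailIntegral.locallyIntegrable
  growth := by
    obtain ⟨C, N, hC⟩ := hf.growth
    refine ⟨|C| + ‖tailIntegral f (-1)‖, N + 1, fun t ht => ?_⟩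
    have h1 : (1 : ℝ) ≤ (1 + |t|) ^ (N + 1) := one_le_pow₀ (by linarith [abs_nonneg t])
    have h2 : ‖∫ x in (-1)..t, f x‖ ≤ (|C| * (1 + |t|) ^ N) * |t - -1| := by
      refine intervalIntegral.norm_integral_le_of_norm_le_const fun x hx => ?_
      rw [uIoc_of_ge ht] at hx
      refine (hC x hx.2).trans ?_
      have : |x| ≤ |t| := by
        rw [abs_of_nonpos (by linarith [hx.2]), abs_of_nonpos (by linarith)]; linarith [hx.1]
      gcongr
      exact le_abs_self C
    have h3 : |t - -1| ≤ 1 + |t| := by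
      simpa [add_comm] using abs_add_le t 1
    calc ‖tailIntegral f t‖ ≤ ‖tailIntegral f (-1)‖ + ‖∫ x in (-1)..t, f x‖ := by
          rw [hf.tailIntegral_eq (-1) t]; exact norm_sub_le _ _
      _ ≤ ‖tailIntegral f (-1)‖ * (1 + |t|) ^ (N + 1) +
          (|C| * (1 + |t|) ^ N) * (1 + |t|) := by
          gcongr
          · exact le_mul_of_one_le_right (norm_nonneg _) h1
          · exact h2.trans (by gcongr)
      _ = _ := by ring
  decay N := by
    -- Two powers pay for integrability through 1/(1 + x²); the other N leave the integral because
    -- |t| ≤ |x| there.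
    obtain ⟨C, hC⟩ := hf.decay (N + 2)
    refine ⟨C * ∫ x : ℝ, (1 + x ^ 2)⁻¹, fun t ht => ?_⟩
    have hC0 : 0 ≤ C := le_trans (by positivity) (hC 1 le_rfl)
    have hb : ‖tailIntegral f t‖ ≤
        ∫ x in Ioi t, C * ((1 + |t|) ^ N)⁻¹ * (1 + x ^ 2)⁻¹ := by
      refine norm_integral_le_of_norm_le (integrable_inv_one_add_sq.integrableOn.const_mul _)
        ((ae_restrict_mem measurableSet_Ioi).mono fun x hx => ?_)
      have hx' : t < x := hx
      refine le_mul_inv_one_add_sq (norm_nonneg _) ?_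
      rw [← div_eq_mul_inv, le_div_iff₀ (by positivity)]
      refine le_trans ?_ (hC x (by linarith))
      rw [pow_add, mul_assoc, mul_comm ((1 + |x|) ^ 2)]
      have : |t| ≤ |x| := by
        rw [abs_of_nonneg (by linarith), abs_of_nonneg (by linarith)]; exact hx'.le
      gcongr
    rw [integral_const_mul] at hb
    have hc : ∫ x in Ioi t, (1 + x ^ 2)⁻¹ ≤ ∫ x : ℝ, (1 + x ^ 2)⁻¹ :=
      setIntegral_le_integral integrable_inv_one_add_sq (ae_of_all _ fun x => by positivity)
    rw [← le_div_iff₀ (by positivity)]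
    refine hb.trans ?_
    rw [div_eq_mul_inv, mul_right_comm]
    gcongr

theorem iterate_tailIntegral (hf : DecaysRight f) (m : ℕ) :
    DecaysRight (tailIntegral^[m] f) := by
  induction m generalizing f with
  | zero => exact hf
  | succ m ih => exact ih hf.decaysRight_tailIntegral

end DecaysRight

end decays

theorem tailIntegral_ofReal (f : ℝ → ℝ) :
    tailIntegral (fun x => (f x : ℂ)) = fun t => ((tailIntegral f t : ℝ) : ℂ) :=
  funext fun _ => integral_ofReal

theorem DecaysRight.re {f : ℝ → ℂ} (hf : DecaysRight f) : DecaysRight fun x => (f x).re :=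
  hf.mono (Complex.continuous_re.comp_aestronglyMeasurable hf.aestronglyMeasurable)
    fun _ => Complex.abs_re_le_norm _

theorem DecaysRight.ofReal {f : ℝ → ℝ} (hf : DecaysRight f) : DecaysRight fun x => (f x : ℂ) :=
  hf.mono (Complex.continuous_ofReal.comp_aestronglyMeasurable hf.aestronglyMeasurable)
    fun _ => by simp

theorem DecaysRight.re_iterate_tailIntegral {f : ℝ → ℂ} (hf : DecaysRight f) (m : ℕ) (t : ℝ) :
    (tailIntegral^[m] f t).re = tailIntegral^[m] (fun x => (f x).re) t := by
  induction m generalizing f t with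
  | zero => rfl
  | succ m ih =>
    rw [Function.iterate_succ_apply, Function.iterate_succ_apply, ih hf.decaysRight_tailIntegral]
    exact congrArg (fun g => tailIntegral^[m] g t)
      (funext fun t => (integral_re (hf.integrableOn_Ioi t)).symm)

theorem iterate_tailIntegral_ofReal (f : ℝ → ℝ) (m : ℕ) :
    tailIntegral^[m] (fun x => (f x : ℂ)) = fun t => ((tailIntegral^[m] f t : ℝ) : ℂ) := by
  induction m generalizing f with
  | zero => rfl
  | succ m ih => rw [Function.iterate_succ_apply, tailIntegral_ofReal, ih]; rfl

/-! ### The reflected pairing and its adjunction -/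

/-- After the reflection, polynomial growth of one factor meets rapid decay of the other at both
ends. On [-1, 1] continuity of `v` compensates for `u` being only integrable. -/
theorem DecaysRight.integrable_comp_neg_mul {u v : ℝ → ℂ} (hu : DecaysRight u)
    (hv : DecaysRight v) (hc : Continuous v) : Integrable fun x => u (-x) * v x := by
  have hun : AEStronglyMeasurable fun x => u (-x) :=
    hu.aestronglyMeasurable.comp_measurePreserving (Measure.measurePreserving_neg volume)
  have hm : AEStronglyMeasurable fun x => u (-x) * v x := hun.mul hc.aestronglyMeasurable
  obtain ⟨C, N, hC⟩ := hu.growth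
  obtain ⟨C', N', hC'⟩ := hv.growth
  obtain ⟨D, hD⟩ := hu.decay (N' + 2)
  obtain ⟨D', hD'⟩ := hv.decay (N + 2)
  have key : ∀ (a b c d x : ℝ) (n : ℕ), 0 ≤ a → 0 ≤ b → a ≤ c * (1 + |x|) ^ n →
      b * (1 + |x|) ^ (n + 2) ≤ d → a * b ≤ |c| * d * (1 + x ^ 2)⁻¹ := by
    intro a b c d x n ha hb h1 h2
    refine le_mul_inv_one_add_sq (mul_nonneg ha hb) ?_
    calc a * b * (1 + |x|) ^ 2 ≤ (|c| * (1 + |x|) ^ n) * b * (1 + |x|) ^ 2 := by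
          gcongr
          exact h1.trans (by gcongr; exact le_abs_self c)
      _ = |c| * (b * (1 + |x|) ^ (n + 2)) := by ring
      _ ≤ |c| * d := by gcongr
  have h1 : IntegrableOn (fun x => u (-x) * v x) (Ici 1) := by
    refine Integrable.mono' (integrable_inv_one_add_sq.const_mul (|C| * D')).integrableOn
      hm.restrict ((ae_restrict_mem measurableSet_Ici).mono fun x hx => ?_)
    rw [norm_mul]
    refine key _ _ _ _ _ _ (norm_nonneg _) (norm_nonneg _) ?_ (hD' x hx)
    simpa using hC (-x) (neg_le_neg hx)
  have h2 : IntegrableOn (fun x => u (-x) * v x) (Iic (-1)) := by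
    refine Integrable.mono' (integrable_inv_one_add_sq.const_mul (|C'| * D)).integrableOn
      hm.restrict ((ae_restrict_mem measurableSet_Iic).mono fun x hx => ?_)
    have hx' : x ≤ -1 := hx
    rw [norm_mul, mul_comm]
    refine key _ _ _ _ _ _ (norm_nonneg _) (norm_nonneg _) (hC' x hx) ?_
    simpa using hD (-x) (by linarith)
  have h3 : IntegrableOn (fun x => u (-x) * v x) (Icc (-1) 1) := by
    have : IntegrableOn (fun x => u (-x)) (Icc (-1) 1) := by
      have h := ((Measure.measurePreserving_neg (volume : Measure ℝ)).integrableOn_comp_preimage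
        (Homeomorph.neg ℝ).measurableEmbedding (s := Icc (-1) 1) (f := u)).2
        (hu.locallyIntegrable.integrableOn_isCompact isCompact_Icc)
      have hpre : (Neg.neg ⁻¹' Icc (-1 : ℝ) 1 : Set ℝ) = Icc (-1) 1 := by
        ext x; simp only [mem_preimage, mem_Icc]; constructor <;> rintro ⟨h, h'⟩ <;>
          constructor <;> linarith
      rw [hpre] at h
      exact h
    exact this.mul_continuousOn hc.continuousOn isCompact_Icc
  rw [← integrableOn_univ]
  refine ((h2.union h3).union h1).mono_set fun x _ => ?_
  rcases le_total x (-1) with h | h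
  · exact Or.inl (Or.inl h)
  rcases le_total x 1 with h' | h'
  · exact Or.inl (Or.inr ⟨h, h'⟩)
  · exact Or.inr h'

/-- `∬_{w < y} u(-w) v(y)` computed in the two possible orders. -/
theorem DecaysRight.integral_comp_neg_mul_tailIntegral {u v : ℝ → ℂ} (hu : DecaysRight u)
    (hv : DecaysRight v) :
    ∫ x, u (-x) * tailIntegral v x = ∫ x, tailIntegral u (-x) * v x := by
  have hun : AEStronglyMeasurable fun x => u (-x) :=
    hu.aestronglyMeasurable.comp_measurePreserving (Measure.measurePreserving_neg volume)
  let K : ℝ × ℝ → ℂ := {p : ℝ × ℝ | p.1 < p.2}.indicator fun p => u (-p.1) * v p.2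
  have hset : MeasurableSet {p : ℝ × ℝ | p.1 < p.2} :=
    (isOpen_lt continuous_fst continuous_snd).measurableSet
  have hKm : AEStronglyMeasurable K (volume.prod volume) :=
    (AEStronglyMeasurable.mul (hun.comp_fst) (hv.aestronglyMeasurable.comp_snd)).indicator hset
  have hK1 : ∀ w, (fun y => K (w, y)) = (Ioi w).indicator fun y => u (-w) * v y := by
    intro w; ext y; simp [K, indicator]
  have hK2 : ∀ y, (fun w => K (w, y)) = (Iio y).indicator fun w => u (-w) * v y := by
    intro y; ext w; simp [K, indicator]
  -- Integrating |K| over y gives |u(-w)| times the tail integral of |v|. That tail is continuous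
  -- and again in the class, so the pairing lemma applies even if `v` is not continuous.
  have hKi : Integrable K (volume.prod volume) := by
    rw [integrable_prod_iff hKm]
    refine ⟨ae_of_all _ fun w => ?_, ?_⟩
    · rw [hK1, integrable_indicator_iff measurableSet_Ioi]
      exact (hv.integrableOn_Ioi w).const_mul _
    · have : (fun w => ∫ y, ‖K (w, y)‖) = fun w => ‖u (-w) * (tailIntegral (fun y => ‖v y‖) w : ℝ)‖ := by
        ext w
        have h0 : 0 ≤ tailIntegral (fun y => ‖v y‖) w :=
          setIntegral_nonneg measurableSet_Ioi fun _ _ => norm_nonneg _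
        rw [norm_mul, Complex.norm_real, Real.norm_of_nonneg h0, tailIntegral,
          ← integral_const_mul, ← integral_indicator measurableSet_Ioi]
        congr 1
        ext y
        rw [congrFun (hK1 w) y, norm_indicator_eq_indicator_norm]
        simp [indicator]
      rw [this]
      exact (hu.integrable_comp_neg_mul hv.norm.decaysRight_tailIntegral.ofReal
        (Complex.continuous_ofReal.comp hv.norm.continuous_tailIntegral)).norm
  have hswap := integral_integral_swap (f := fun w y => K (w, y)) hKi
  have e1 : ∀ w, ∫ y, K (w, y) = u (-w) * tailIntegral v w := by
    intro w
    rw [hK1, integral_indicator measurableSet_Ioi, integral_const_mul, tailIntegral]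
  have e2 : ∀ y, ∫ w, K (w, y) = tailIntegral u (-y) * v y := by
    intro y
    rw [hK2, integral_indicator measurableSet_Iio, integral_mul_const, tailIntegral,
      ← integral_Iic_eq_integral_Iio, integral_comp_neg_Iic]
  simpa only [e1, e2] using hswap

/-! ### Convolution with γ₊ at positive integers as iterated integration -/

theorem halfLineIntegral_natCast_add_one (k : ℕ) (g : ℝ → ℂ) (t : ℝ) :
    halfLineIntegral ((k : ℂ) + 1) g t = ∫ x in Ioi t, ((x : ℂ) - t) ^ k * g x := by
  have h := (measurePreserving_add_right (volume : Measure ℝ) t).setIntegral_preimage_emb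
    (measurableEmbedding_addRight t) (fun x : ℝ => ((x : ℂ) - t) ^ k * g x) (Ioi t)
  have hpre : (fun x => x + t) ⁻¹' Ioi t = Ioi 0 := by ext x; simp
  rw [hpre] at h
  rw [← h, halfLineIntegral]
  simp

/-- Integration by parts, using that the tail integral of `v` has derivative -v. The boundary terms
vanish at t because of the power and at ∞ by rapid decay. -/
theorem DecaysRight.integral_sub_pow_succ_mul {v : ℝ → ℂ} (hv : DecaysRight v)
    (hc : Continuous v) (t : ℝ) (k : ℕ) :
    ∫ x in Ioi t, ((x : ℂ) - t) ^ (k + 1) * v x =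
      ((k : ℂ) + 1) * ∫ x in Ioi t, ((x : ℂ) - t) ^ k * tailIntegral v x := by
  have hd := hv.decaysRight_tailIntegral
  have hu (x : ℝ) : HasDerivAt (fun x : ℝ => ((x : ℂ) - t) ^ (k + 1))
      (((k : ℂ) + 1) * ((x : ℂ) - t) ^ k) x := by
    simpa using! ((hasDerivAt_id x).ofReal_comp.sub_const (t : ℂ)).pow (k + 1)
  have h := integral_Ioi_mul_deriv_eq_deriv_mul (a := t) (a' := 0) (b' := 0)
    (u := fun x : ℝ => ((x : ℂ) - t) ^ (k + 1)) (v := tailIntegral v)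
    (fun x _ => hu x) (fun x _ => hv.hasDerivAt_tailIntegral hc.continuousAt)
    (by
      have := ((hv.sub_pow_mul t (k + 1)).integrableOn_Ioi t).neg
      refine this.congr_fun (fun x _ => ?_) measurableSet_Ioi
      simp)
    (by
      have : IntegrableOn (fun x : ℝ => ((k : ℂ) + 1) * (((x : ℂ) - t) ^ k * tailIntegral v x))
          (Ioi t) := ((hd.sub_pow_mul t k).integrableOn_Ioi t).const_mul _
      refine this.congr_fun (fun x _ => ?_) measurableSet_Ioi
      simp [mul_assoc])
    (by
      have hcont : Continuous ((fun x : ℝ => ((x : ℂ) - t) ^ (k + 1)) * tailIntegral v) :=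
        Continuous.mul (by fun_prop) hv.continuous_tailIntegral
      refine (hcont.tendsto' t 0 (by simp)).mono_left nhdsWithin_le_nhds)
    (hd.sub_pow_mul t (k + 1)).tendsto_zero
  simp only [mul_neg, integral_neg, mul_assoc, integral_const_mul] at h
  linear_combination -h

theorem DecaysRight.integral_sub_pow_mul {v : ℝ → ℂ} (hv : DecaysRight v) (hc : Continuous v)
    (t : ℝ) (k : ℕ) :
    ∫ x in Ioi t, ((x : ℂ) - t) ^ k * v x = k.factorial * tailIntegral^[k + 1] v t := by
  induction k generalizing v with
  | zero => simp [tailIntegral]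
  | succ k ih =>
    rw [hv.integral_sub_pow_succ_mul hc, ih hv.decaysRight_tailIntegral hv.continuous_tailIntegral,
      ← Function.iterate_succ_apply, Nat.factorial_succ]
    push_cast
    ring

/-- Here `gammaOrder` is 0, so φ is not differentiated, and Γ(m + 1) = m! cancels the factorial of
Cauchy's formula. -/
theorem gammaPairing_natCast_add_one (m : ℕ) (φ : 𝓢(ℝ, ℂ)) (hφ : DecaysRight φ) :
    gammaPairing ((m + 1 : ℕ) : ℂ) φ = tailIntegral^[m + 1] φ := by
  ext t
  have h0 : gammaOrder ((m + 1 : ℕ) : ℂ) = 0 := by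
    simp [gammaOrder]
  have hf : (m.factorial : ℂ) ≠ 0 := by exact_mod_cast m.factorial_ne_zero
  rw [gammaPairing, h0]
  simp only [pow_zero, Nat.cast_zero, add_zero, iteratedDeriv_zero]
  push_cast
  rw [halfLineIntegral_natCast_add_one, hφ.integral_sub_pow_mul φ.continuous,
    Complex.Gamma_nat_eq_factorial]
  field_simp

theorem decaysRight_schwartz (φ : 𝓢(ℝ, ℂ)) : DecaysRight φ := by
  have h (N : ℕ) : ∃ C : ℝ, ∀ x, ‖φ x‖ * (1 + |x|) ^ N ≤ C := by
    refine ⟨2 ^ N * (Finset.Iic (N, 0)).sup (schwartzSeminormFamily ℂ ℝ ℂ) φ, fun x => ?_⟩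
    have := SchwartzMap.one_add_le_sup_seminorm_apply (𝕜 := ℂ) (m := (N, 0)) le_rfl le_rfl φ x
    rw [norm_iteratedFDeriv_zero, Real.norm_eq_abs, mul_comm] at this
    exact this
  refine ⟨φ.continuous.locallyIntegrable, ?_, fun N => ?_⟩
  · obtain ⟨C, hC⟩ := h 0
    exact ⟨C, 0, fun x _ => by simpa using hC x⟩
  · obtain ⟨C, hC⟩ := h N
    exact ⟨C, fun x _ => hC x⟩

/-! ### The kernel Li₁(e^(-x)) -/

/-- A smooth function `σ` with `log |1 - e^x| = log |x| + σ(x)` for `x ≠ 0`. -/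
theorem exists_log_one_sub_exp :
    ∃ σ : ℝ → ℝ, ContDiff ℝ ∞ σ ∧
      ∀ x, x ≠ 0 → Real.log (1 - Real.exp x) = Real.log x + σ x := by
  -- E is (e^z - 1)/z with its removable singularity filled; passing to ℂ gives smoothness from
  -- holomorphy. Since `Real.log` is log |·|, nonvanishing of E on the real axis is enough.
  let E : ℂ → ℂ := dslope Complex.exp 0
  have hE : Differentiable ℂ E := by
    rw [← differentiableOn_univ, Complex.differentiableOn_dslope univ_mem]
    exact Complex.differentiable_exp.differentiableOn
  have hr : ContDiff ℝ ∞ fun x : ℝ => (E x).re :=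
    Complex.reCLM.contDiff.comp
      ((hE.contDiff.restrict_scalars ℝ).comp Complex.ofRealCLM.contDiff)
  have hval : ∀ x : ℝ, x ≠ 0 → (E x).re = (Real.exp x - 1) / x := by
    intro x hx
    have : E x = (((Real.exp x - 1) / x : ℝ) : ℂ) := by
      have hx' : (x : ℂ) ≠ 0 := by exact_mod_cast hx
      simp only [E]
      rw [dslope_of_ne _ hx', slope_def_field]
      push_cast
      simp
    rw [this, Complex.ofReal_re]
  have hne : ∀ x : ℝ, (E x).re ≠ 0 := by
    intro x
    by_cases hx : x = 0
    · subst hx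
      simp only [E, Complex.ofReal_zero, dslope_same]
      simp [(Complex.hasDerivAt_exp 0).deriv]
    · rw [hval x hx]
      refine div_ne_zero (fun h => hx ?_) hx
      rwa [sub_eq_zero, Real.exp_eq_one_iff] at h
  refine ⟨fun x => Real.log (E x).re, hr.log hne, fun x hx => ?_⟩
  rw [← Real.log_mul hx (hne x), hval x hx, mul_div_cancel₀ _ hx, ← Real.log_neg_eq_log, neg_sub]

/-- `Li₁(e^(-x))`. -/
def liOneExp (x : ℝ) : ℂ := -Complex.log (1 - (Real.exp (-x) : ℂ))

theorem liOneExp_re (x : ℝ) : (liOneExp x).re = -Real.log (1 - Real.exp (-x)) := by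
  rw [liOneExp, Complex.neg_re, Complex.log_re, ← Complex.ofReal_one, ← Complex.ofReal_sub,
    Complex.norm_real, Real.norm_eq_abs, Real.log_abs]

/-- The imaginary part is an argument up to sign, hence at most π ≤ 4 in absolute value. -/
theorem norm_liOneExp_le (x : ℝ) : ‖liOneExp x‖ ≤ |Real.log (1 - Real.exp (-x))| + 4 := by
  refine (Complex.norm_le_abs_re_add_abs_im _).trans ?_
  rw [liOneExp_re, abs_neg]
  have : |(liOneExp x).im| ≤ Real.pi := by
    rw [liOneExp, Complex.neg_im, abs_neg, Complex.log_im]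
    exact Complex.abs_arg_le_pi _
  linarith [Real.pi_le_four]

theorem norm_liOneExp_le_of_one_le {x : ℝ} (hx : 1 ≤ x) : ‖liOneExp x‖ ≤ 2 * Real.exp (-x) := by
  have h1 : Real.exp (-x) ≤ 1 / 2 := by
    have h2 : Real.exp (-x) * Real.exp x = 1 := by rw [← Real.exp_add]; simp
    nlinarith [Real.add_one_le_exp x, Real.exp_pos (-x)]
  have hpos : 0 < 1 - Real.exp (-x) := by linarith
  have he := Real.exp_pos (-x)
  rw [liOneExp, norm_neg, ← Complex.ofReal_one, ← Complex.ofReal_sub, ← Complex.ofReal_log hpos.le,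
    Complex.norm_real, Real.norm_of_nonpos (Real.log_nonpos hpos.le (by linarith))]
  have h3 := Real.one_sub_inv_le_log_of_pos hpos
  have h4 : (1 - Real.exp (-x))⁻¹ ≤ 1 + 2 * Real.exp (-x) := by
    rw [inv_le_iff_one_le_mul₀ hpos]
    nlinarith
  linarith

/-- The only singularity is logarithmic, at 0. At -∞ the growth is linear, since 0 < e^(-x) - 1 ≤
e^(-x); at +∞ the decay is exponential. -/
theorem decaysRight_liOneExp : DecaysRight liOneExp where
  locallyIntegrable := by
    obtain ⟨σ, hσ, h⟩ := exists_log_one_sub_exp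
    have hlog : LocallyIntegrable fun x => |Real.log x| := by
      rw [locallyIntegrable_iff]
      intro k hk
      obtain ⟨r, hr⟩ := hk.isBounded.subset_closedBall 0
      rw [Real.closedBall_eq_Icc] at hr
      refine IntegrableOn.mono_set ?_ hr
      rcases le_or_gt (0 - r) (0 + r) with h0 | h0
      · exact (intervalIntegrable_iff_integrableOn_Icc_of_le h0).1
          intervalIntegral.intervalIntegrable_log'.abs
      · rw [Icc_eq_empty_of_lt h0]
        exact integrableOn_empty
    have hmaj : LocallyIntegrable fun x => |Real.log x| + (|σ (-x)| + 4) :=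
      hlog.add (Continuous.locallyIntegrable (by have := hσ.continuous; fun_prop))
    refine hmaj.mono (Measurable.aestronglyMeasurable (by unfold liOneExp; fun_prop)) ?_
    have : ∀ᵐ x : ℝ, x ≠ 0 := by simp [ae_iff]
    filter_upwards [this] with x hx
    refine (norm_liOneExp_le x).trans ?_
    rw [h (-x) (neg_ne_zero.2 hx), Real.log_neg_eq_log, Real.norm_of_nonneg (by positivity)]
    linarith [abs_add_le (Real.log x) (σ (-x))]
  growth := by
    refine ⟨4, 1, fun x hx => (norm_liOneExp_le x).trans ?_⟩
    have h1 := Real.add_one_le_exp (-x)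
    rw [← Real.log_neg_eq_log, neg_sub, abs_of_nonneg (Real.log_nonneg (by linarith)),
      abs_of_nonpos (by linarith)]
    have h2 : Real.log (Real.exp (-x) - 1) ≤ -x := by
      rw [Real.log_le_iff_le_exp (by linarith)]; linarith
    linarith
  decay N := by
    refine ⟨2 * (Real.exp 1 * N.factorial), fun x hx => ?_⟩
    rw [abs_of_nonneg (by linarith)]
    have h := Real.pow_div_factorial_le_exp (1 + x) (by linarith) N
    rw [div_le_iff₀ (by positivity), Real.exp_add] at h
    have h2 : Real.exp (-x) * Real.exp x = 1 := by rw [← Real.exp_add]; simp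
    calc ‖liOneExp x‖ * (1 + x) ^ N
        ≤ (2 * Real.exp (-x)) * (Real.exp 1 * Real.exp x * N.factorial) := by
          gcongr
          exact norm_liOneExp_le_of_one_le hx
      _ = 2 * (Real.exp 1 * N.factorial) * (Real.exp (-x) * Real.exp x) := by ring
      _ = _ := by rw [h2, mul_one]

/-- The real part of `Li₁(e^(-x))`. -/
def logKernel (x : ℝ) : ℝ := (liOneExp x).re

theorem logKernel_eq (x : ℝ) : logKernel x = -Real.log (1 - Real.exp (-x)) := liOneExp_re x

theorem decaysRight_logKernel : DecaysRight logKernel := decaysRight_liOneExp.re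

/-- Factor 1 - e^t = -e^t (1 - e^(-t)). The linear term produced here matches the summand -F(t) of
`symmetrized`. -/
theorem logKernel_neg {t : ℝ} (ht : 0 < t) : logKernel (-t) = logKernel t - t := by
  have h1 : Real.exp (-t) < 1 := by rw [Real.exp_lt_one_iff]; linarith
  have h2 : 1 - Real.exp t = -(Real.exp t * (1 - Real.exp (-t))) := by
    rw [mul_sub, ← Real.exp_add]; simp
  rw [logKernel_eq, logKernel_eq, neg_neg, h2, Real.log_neg_eq_log,
    Real.log_mul (Real.exp_pos t).ne' (by linarith), Real.log_exp]
  ring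

theorem hasDerivAt_logKernel {t : ℝ} (ht : 0 < t) :
    HasDerivAt logKernel (-(1 / (Real.exp t - 1))) t := by
  have h1 : Real.exp (-t) < 1 := by rw [Real.exp_lt_one_iff]; linarith
  have h2 : Real.exp (-t) * Real.exp t = 1 := by rw [← Real.exp_add]; simp
  have h3 : 1 < Real.exp t := Real.one_lt_exp_iff.2 ht
  have h4 : 1 - Real.exp (-t) ≠ 0 := by linarith
  have h5 : Real.exp t - 1 ≠ 0 := by linarith
  have h := ((((hasDerivAt_id t).neg.exp).const_sub 1).log h4).neg
  rw [show logKernel = fun x => -Real.log (1 - Real.exp (-x)) from funext logKernel_eq]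
  convert! h using 1
  simp only [Pi.neg_apply, id_eq]
  field_simp
  linarith

/-! ### From li₀ to li₁ by parts -/

/-- The principal value of `li₀` against `∫_t^∞ v` is the integral of `li₁ v`. -/
theorem integral_symmetrized_tailIntegral {v : ℝ → ℂ} (hv : DecaysRight v) (hc : Continuous v)
    (hi : IntegrableOn (symmetrized (tailIntegral v)) (Ioi 0)) :
    ∫ t in Ioi (0 : ℝ), symmetrized (tailIntegral v) t = ∫ x, (logKernel (-x) : ℂ) * v x := by
  set F := tailIntegral v with hF
  have hFd : DecaysRight F := hv.decaysRight_tailIntegral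
  have hint : Integrable fun x => (logKernel (-x) : ℂ) * v x :=
    decaysRight_logKernel.ofReal.integrable_comp_neg_mul hv hc
  have hF1 (t : ℝ) : HasDerivAt F (-v t) t := hv.hasDerivAt_tailIntegral hc.continuousAt
  have hD (t : ℝ) : HasDerivAt (fun t => F (-t) - F t) (v (-t) + v t) t := by
    have h := ((hF1 (-t)).scomp t (hasDerivAt_neg t)).sub (hF1 t)
    convert! h using 1
    simp
  -- R is the right-hand integrand folded onto the positive half-line, as `symmetrized` folds the
  -- left-hand one.
  let R : ℝ → ℂ := fun t => (logKernel (-t) : ℂ) * v t + (logKernel t : ℂ) * v (-t)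
  have hneg : IntegrableOn (fun t => (logKernel t : ℂ) * v (-t)) (Ioi 0) := by
    have := hint.comp_neg
    simp only [neg_neg] at this
    exact this.integrableOn
  have hRi : IntegrableOn R (Ioi 0) := hint.integrableOn.add hneg
  have hR : ∫ t in Ioi (0 : ℝ), R t = ∫ x, (logKernel (-x) : ℂ) * v x := by
    have h1 := integral_add (μ := volume.restrict (Ioi (0 : ℝ))) hint.integrableOn hneg
    have h2 := integral_comp_neg_Ioi (0 : ℝ) fun x => (logKernel (-x) : ℂ) * v x
    simp only [neg_neg, neg_zero] at h2
    refine h1.trans ?_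
    rw [h2, add_comm]
    exact intervalIntegral.integral_Iic_add_Ioi hint.integrableOn hint.integrableOn
  -- The boundary term of the integration by parts: H' is the difference of the two folded
  -- integrands, and H vanishes at 0 and at ∞.
  let H : ℝ → ℂ := fun t => -((logKernel t : ℂ) * (F (-t) - F t)) - (t : ℂ) * F t
  have hderiv : ∀ t ∈ Ioi (0 : ℝ), HasDerivAt H (symmetrized F t - R t) t := by
    intro t ht
    have ht' : 0 < t := ht
    have h := (((hasDerivAt_logKernel ht').ofReal_comp.mul (hD t)).neg).sub
      ((hasDerivAt_id t).ofReal_comp.mul (hF1 t))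
    convert! h using 1
    simp only [R, symmetrized, logKernel_neg ht']
    push_cast
    simp only [id_eq]
    ring
  obtain ⟨σ, hσ, hlog⟩ := exists_log_one_sub_exp
  have hcont : ContinuousAt H 0 := by
    -- F(-t) - F(t) vanishes at 0 and is differentiable there, so dividing it by t turns the
    -- logarithm into the continuous function t log t.
    have hH : H = fun t => dslope (fun t => F (-t) - F t) 0 t * ((t * Real.log t : ℝ) : ℂ) +
        (σ (-t) : ℂ) * (F (-t) - F t) - (t : ℂ) * F t := by
      ext t
      by_cases ht : t = 0
      · subst ht; simp [H]
      · have ht' : (t : ℂ) ≠ 0 := by exact_mod_cast ht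
        simp only [H]
        rw [dslope_of_ne _ ht, logKernel_eq, hlog _ (neg_ne_zero.2 ht), Real.log_neg_eq_log,
          slope, vsub_eq_sub]
        simp only [neg_zero, sub_self, sub_zero, Complex.real_smul]
        push_cast
        field_simp
    rw [hH]
    have hFc : Continuous F := hv.continuous_tailIntegral
    have hd : ContinuousAt (dslope (fun t => F (-t) - F t) 0) 0 :=
      continuousAt_dslope_same.2 (hD 0).differentiableAt
    have hσc := hσ.continuous
    refine ((hd.mul ?_).add ?_).sub ?_
    · exact (Complex.continuous_ofReal.comp Real.continuous_mul_log).continuousAt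
    · exact Continuous.continuousAt (by fun_prop)
    · exact Continuous.continuousAt (by fun_prop)
  have hinf : Tendsto H atTop (𝓝 0) := by
    -- F(-t) may grow polynomially; the rapid decay of the kernel beats it.
    have h1 : Tendsto (fun t => (logKernel t : ℂ) * F (-t)) atTop (𝓝 0) := by
      obtain ⟨C, N, hC⟩ := hFd.growth
      obtain ⟨C', hC'⟩ := decaysRight_logKernel.decay (N + 1)
      refine squeeze_zero_norm' (a := fun t : ℝ => |C| * C' / t) ?_
        (tendsto_const_nhds.div_atTop tendsto_id)
      filter_upwards [eventually_ge_atTop 1] with t ht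
      have h2 := hC (-t) (by linarith)
      have h3 := hC' t ht
      rw [abs_neg, abs_of_nonneg (by linarith)] at h2
      rw [abs_of_nonneg (by linarith)] at h3
      rw [le_div_iff₀ (by linarith), norm_mul, Complex.norm_real]
      calc ‖logKernel t‖ * ‖F (-t)‖ * t ≤ ‖logKernel t‖ * (|C| * (1 + t) ^ N) * (1 + t) := by
            gcongr
            · exact h2.trans (by gcongr; exact le_abs_self C)
            · linarith
        _ = |C| * (‖logKernel t‖ * (1 + t) ^ (N + 1)) := by ring
        _ ≤ |C| * C' := by gcongr
    have h2 := decaysRight_logKernel.ofReal.tendsto_zero.mul hFd.tendsto_zero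
    have h3 := (hFd.sub_pow_mul 0 1).tendsto_zero
    have h := ((h1.sub h2).neg).sub h3
    simp only [mul_zero, sub_zero, neg_zero] at h
    refine h.congr fun t => ?_
    simp only [H]
    simp
    ring
  have h := integral_Ioi_of_hasDerivAt_of_tendsto hcont.continuousWithinAt hderiv
    (hi.sub hRi) hinf
  have hH0 : H 0 = 0 := by simp [H]
  rw [hH0, sub_zero, integral_sub hi hRi, hR] at h
  exact sub_eq_zero.1 h

theorem DecaysRight.integral_comp_neg_mul_iterate {u v : ℝ → ℂ} (hu : DecaysRight u)
    (hv : DecaysRight v) (m : ℕ) :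
    ∫ x, u (-x) * tailIntegral^[m] v x = ∫ x, tailIntegral^[m] u (-x) * v x := by
  induction m generalizing u with
  | zero => rfl
  | succ m ih =>
    rw [Function.iterate_succ_apply', Function.iterate_succ_apply, ← ih hu.decaysRight_tailIntegral]
    exact hu.integral_comp_neg_mul_tailIntegral (hv.iterate_tailIntegral m)

theorem continuous_iterate_tailIntegral {v : ℝ → ℂ} (hv : DecaysRight v) (hc : Continuous v)
    (m : ℕ) : Continuous (tailIntegral^[m] v) := by
  cases m with
  | zero => exact hc
  | succ m =>
    rw [Function.iterate_succ_apply']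
    exact (hv.iterate_tailIntegral m).continuous_tailIntegral

/-! ### Positive integer li as the function Re Li(e^x) -/

/-- The function `Re Li_{m+1}(e^x)`, an `m`-fold primitive of `-log |1 - e^x|`. -/
def realPolylog (m : ℕ) (x : ℝ) : ℝ := tailIntegral^[m] logKernel (-x)

/-- Of the m + 1 tail integrations of φ, the outermost is spent in turning li₀ into li₁; the other m
pass to the kernel by adjunction. -/
theorem isGivenBy_polylogDist (m : ℕ) :
    IsGivenBy (polylogDist ((m + 1 : ℕ) : ℂ)) fun x => (realPolylog m x : ℂ) := by
  intro φ
  have hφ := decaysRight_schwartz φ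
  have hu := decaysRight_logKernel.ofReal.iterate_tailIntegral m
  rw [iterate_tailIntegral_ofReal] at hu
  refine ⟨hu.integrable_comp_neg_mul hφ φ.continuous, ?_⟩
  have hi := integrableOn_symmetrized_gammaPairing ((m + 1 : ℕ) : ℂ) φ
  rw [polylogDist_apply, polylogPairing_eq]
  rw [gammaPairing_natCast_add_one m φ hφ, Function.iterate_succ_apply'] at hi ⊢
  rw [integral_symmetrized_tailIntegral (hφ.iterate_tailIntegral m)
    (continuous_iterate_tailIntegral hφ φ.continuous m) hi,
    decaysRight_logKernel.ofReal.integral_comp_neg_mul_iterate hφ m, iterate_tailIntegral_ofReal]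
  rfl

/-- With u = e^(x-y) one has u e^(-x) = e^(-y) and |du|/u = dy, while (0, 1) corresponds to (x, ∞):
each step of the recursion is one tail integral. The sign of x plays no role, so points on the cut
are included. -/
theorem Li_exp_neg (m : ℕ) (x : ℝ) :
    Li (m + 1) (Real.exp (-x) : ℂ) = tailIntegral^[m] liOneExp x := by
  induction m generalizing x with
  | zero => rw [Li]; rfl
  | succ m ih =>
    rw [Li, Function.iterate_succ_apply', tailIntegral,
      intervalIntegral.integral_of_le zero_le_one, integral_Ioc_eq_integral_Ioo]
    have himg : (fun y : ℝ => Real.exp (x - y)) '' Ioi x = Ioo 0 1 := by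
      ext u
      simp only [mem_image, mem_Ioi, mem_Ioo]
      constructor
      · rintro ⟨y, hy, rfl⟩
        exact ⟨Real.exp_pos _, by rw [Real.exp_lt_one_iff]; linarith⟩
      · rintro ⟨h0, h1⟩
        refine ⟨x - Real.log u, by linarith [Real.log_neg h0 h1], ?_⟩
        rw [sub_sub_cancel, Real.exp_log h0]
    have hd (y : ℝ) : HasDerivAt (fun y : ℝ => Real.exp (x - y)) (-Real.exp (x - y)) y := by
      simpa using! ((hasDerivAt_id y).const_sub x).exp
    have hinj : InjOn (fun y : ℝ => Real.exp (x - y)) (Ioi x) := by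
      intro a _ b _ hab
      have := Real.exp_injective hab
      linarith
    rw [← himg, integral_image_eq_integral_abs_deriv_smul measurableSet_Ioi
      (fun y _ => (hd y).hasDerivWithinAt) hinj]
    refine setIntegral_congr_fun measurableSet_Ioi fun y _ => ?_
    have he : ((Real.exp (x - y) : ℝ) : ℂ) ≠ 0 := by exact_mod_cast (Real.exp_pos _).ne'
    have hmul : (Real.exp (x - y) : ℂ) * (Real.exp (-x) : ℂ) = (Real.exp (-y) : ℂ) := by
      rw [← Complex.ofReal_mul, ← Real.exp_add]; ring_nf
    simp only [abs_neg, abs_of_pos (Real.exp_pos (x - y)), Complex.real_smul]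
    rw [hmul, ih, mul_div_cancel₀ _ he]

theorem Li_exp_re (m : ℕ) (x : ℝ) : (Li (m + 1) (Real.exp x : ℂ)).re = realPolylog m x := by
  have h := Li_exp_neg m (-x)
  rw [neg_neg] at h
  rw [h, decaysRight_liOneExp.re_iterate_tailIntegral]
  rfl

/-! ### The logarithmic singularity at the origin -/

theorem hasDerivAt_realPolylog_succ {m : ℕ} {x : ℝ} (h : ContinuousAt (realPolylog m) x) :
    HasDerivAt (realPolylog (m + 1)) (realPolylog m x) x := by
  have hd := decaysRight_logKernel.iterate_tailIntegral m
  have hc : ContinuousAt (tailIntegral^[m] logKernel) (-x) := by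
    have : tailIntegral^[m] logKernel = fun y => realPolylog m (-y) := by
      ext y; rw [realPolylog, neg_neg]
    rw [this]
    refine ContinuousAt.comp (g := realPolylog m) (f := fun y : ℝ => -y) ?_
      continuous_neg.continuousAt
    rwa [neg_neg]
  have h1 := (hd.hasDerivAt_tailIntegral hc).scomp x (hasDerivAt_neg x)
  have e : realPolylog (m + 1) = tailIntegral (tailIntegral^[m] logKernel) ∘ fun y => -y := by
    ext y; rw [realPolylog, Function.iterate_succ_apply']; rfl
  rw [e]
  convert! h1 using 1
  simp [realPolylog]

theorem continuous_realPolylog_succ (m : ℕ) : Continuous (realPolylog (m + 1)) := by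
  have hd := decaysRight_logKernel.iterate_tailIntegral m
  have e : realPolylog (m + 1) = fun y => tailIntegral (tailIntegral^[m] logKernel) (-y) := by
    ext y; rw [realPolylog, Function.iterate_succ_apply']
  rw [e]
  exact hd.continuous_tailIntegral.comp continuous_neg

theorem hasDerivAt_pow_mul_log (m : ℕ) {x : ℝ} (hx : x ≠ 0) :
    HasDerivAt (fun x : ℝ => x ^ (m + 1) / ((m + 1).factorial : ℝ) * Real.log x)
      (x ^ m / (m.factorial : ℝ) * Real.log x + x ^ m / ((m + 1).factorial : ℝ)) x := by
  have h := (((hasDerivAt_pow (m + 1) x).div_const ((m + 1).factorial : ℝ))).mul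
    (Real.hasDerivAt_log hx)
  convert! h using 1
  rw [Nat.factorial_succ]
  have : (m.factorial : ℝ) ≠ 0 := by exact_mod_cast m.factorial_ne_zero
  push_cast
  field_simp
  ring

theorem continuous_pow_mul_log (m : ℕ) :
    Continuous fun x : ℝ => x ^ (m + 1) / ((m + 1).factorial : ℝ) * Real.log x := by
  have : (fun x : ℝ => x ^ (m + 1) / ((m + 1).factorial : ℝ) * Real.log x) =
      fun x => x ^ m / ((m + 1).factorial : ℝ) * (x * Real.log x) := by
    ext x; ring
  rw [this]
  have := Real.continuous_mul_log
  fun_prop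

/-- By induction: integrating x^m/m! · log |x| gives x^(m+1)/(m+1)! · log |x| up to a polynomial,
and the smooth remainder absorbs the polynomial and the integration constant. -/
theorem exists_realPolylog_eq (m : ℕ) :
    ∃ S : ℝ → ℝ, ContDiff ℝ ∞ S ∧
      ∀ x, x ≠ 0 → realPolylog m x = -(x ^ m / (m.factorial : ℝ) * Real.log x) + S x := by
  induction m with
  | zero =>
    obtain ⟨σ, hσ, h⟩ := exists_log_one_sub_exp
    refine ⟨fun x => -σ x, hσ.neg, fun x hx => ?_⟩
    simp only [realPolylog, Function.iterate_zero, id_eq, logKernel_eq, neg_neg, h x hx]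
    simp
    ring
  | succ m ih =>
    obtain ⟨S, hS, h⟩ := ih
    let W : ℝ → ℝ := fun x =>
      realPolylog (m + 1) x + x ^ (m + 1) / ((m + 1).factorial : ℝ) * Real.log x
    have hWc : Continuous W := (continuous_realPolylog_succ m).add (continuous_pow_mul_log m)
    have hw : ContDiff ℝ ∞ fun x => S x + x ^ m / ((m + 1).factorial : ℝ) := by fun_prop
    have hderiv : ∀ x, x ≠ 0 → HasDerivAt W (S x + x ^ m / ((m + 1).factorial : ℝ)) x := by
      intro x hx
      have hca : ContinuousAt (realPolylog m) x := by
        have hev : (fun x => -(x ^ m / (m.factorial : ℝ) * Real.log x) + S x) =ᶠ[𝓝 x]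
            realPolylog m := by
          filter_upwards [isOpen_ne.mem_nhds hx] with y hy using (h y hy).symm
        refine ContinuousAt.congr ?_ hev
        have := hS.continuous.continuousAt (x := x)
        have := Real.continuousAt_log hx
        fun_prop
      convert! (hasDerivAt_realPolylog_succ hca).add (hasDerivAt_pow_mul_log m hx) using 1
      rw [h x hx]
      ring
    -- W is continuous at 0 and its derivative off 0 extends continuously, so W is differentiable at
    -- 0 with that value.
    have hW (x : ℝ) : HasDerivAt W (S x + x ^ m / ((m + 1).factorial : ℝ)) x :=
      hasDerivAt_of_hasDerivAt_of_ne' (x := 0) hderiv hWc.continuousAt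
        hw.continuous.continuousAt x
    refine ⟨W, ?_, fun x _ => by simp only [W]; ring⟩
    rw [contDiff_infty_iff_deriv]
    refine ⟨fun x => (hW x).differentiableAt, ?_⟩
    rwa [show deriv W = _ from funext fun x => (hW x).deriv]

/-! ### Assembling λi_n -/

theorem IsGivenBy.congr_ae {T : 𝓢'(ℝ, ℂ)} {h h' : ℝ → ℂ} (hT : IsGivenBy T h)
    (he : h =ᵐ[volume] h') : IsGivenBy T h' := by
  intro φ
  have he' : (fun x => h x * φ x) =ᵐ[volume] fun x => h' x * φ x := by
    filter_upwards [he] with x hx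
    rw [hx]
  exact ⟨(hT φ).1.congr he', (hT φ).2.trans (integral_congr_ae he')⟩

theorem IsGivenBy.smulLeft {T : 𝓢'(ℝ, ℂ)} {h p : ℝ → ℂ} (hT : IsGivenBy T h)
    (hp : p.HasTemperateGrowth) :
    IsGivenBy (TemperedDistribution.smulLeftCLM ℂ p T) fun x => p x * h x := by
  intro φ
  have h1 := hT (SchwartzMap.smulLeftCLM ℂ p φ)
  have e : (fun x => h x * SchwartzMap.smulLeftCLM ℂ p φ x) = fun x => p x * h x * φ x := by
    ext x
    rw [SchwartzMap.smulLeftCLM_apply_apply hp, smul_eq_mul]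
    ring
  rw [e] at h1
  exact h1

theorem IsGivenBy.sum {ι : Type*} (s : Finset ι) {T : ι → 𝓢'(ℝ, ℂ)} {h : ι → ℝ → ℂ}
    (hT : ∀ i ∈ s, IsGivenBy (T i) (h i)) : IsGivenBy (∑ i ∈ s, T i) fun x => ∑ i ∈ s, h i x := by
  intro φ
  simp only [Finset.sum_mul]
  refine ⟨integrable_finsetSum s fun i hi => (hT i hi φ).1, ?_⟩
  rw [integral_finsetSum s fun i hi => (hT i hi φ).1]
  have : (∑ i ∈ s, T i) φ = ∑ i ∈ s, T i φ := by simp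
  rw [this]
  exact Finset.sum_congr rfl fun i hi => (hT i hi φ).2

/-- The `k`-th coefficient `(-2)^k B_k / k!` of the modified polylogarithm. -/
def modCoeff (k : ℕ) : ℝ := (-2) ^ k * ((bernoulli' k : ℚ) : ℝ) / (k.factorial : ℝ)

theorem isGivenBy_modifiedPolylogDist (n : ℕ) :
    IsGivenBy (modifiedPolylogDist n) fun x =>
      ((∑ k ∈ Finset.range n, modCoeff k * x ^ k * realPolylog (n - k - 1) x : ℝ) : ℂ) := by
  simp only [Complex.ofReal_sum]
  refine IsGivenBy.sum _ fun k hk => ?_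
  have hk' : n - k = n - k - 1 + 1 := by have := Finset.mem_range.1 hk; omega
  have h := (isGivenBy_polylogDist (n - k - 1)).smulLeft (p := fun x : ℝ =>
    ((bernoulli' k : ℚ) : ℂ) * (-2 * (x : ℂ)) ^ k / (k.factorial : ℂ)) (by
      simp only [div_eq_mul_inv]
      have : Function.HasTemperateGrowth fun x : ℝ => (x : ℂ) :=
        Complex.ofRealCLM.hasTemperateGrowth
      fun_prop)
  rw [← hk'] at h
  convert h using 2 with x
  rw [modCoeff]
  push_cast
  ring

theorem classicalModifiedSum_exp_re (n : ℕ) (x : ℝ) :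
    (classicalModifiedSum n (Real.exp x : ℂ)).re =
      ∑ k ∈ Finset.range n, modCoeff k * x ^ k * realPolylog (n - k - 1) x := by
  rw [classicalModifiedSum, Complex.re_sum]
  refine Finset.sum_congr rfl fun k hk => ?_
  have hk' : n - k = n - k - 1 + 1 := by have := Finset.mem_range.1 hk; omega
  have hc : (-2 : ℂ) ^ k * ((bernoulli' k : ℚ) : ℂ) / (k.factorial : ℂ) *
      (Real.log ‖(Real.exp x : ℂ)‖ : ℂ) ^ k = ((modCoeff k * x ^ k : ℝ) : ℂ) := by
    rw [Complex.norm_real, Real.norm_of_nonneg (Real.exp_pos x).le, Real.log_exp, modCoeff]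
    push_cast
    ring
  rw [hc, Complex.re_ofReal_mul, hk', Li_exp_re, ← hk']

/-- All terms carry the same power x^m; after multiplication by m! the coefficients form the
binomial sum `sum_choose_mul_bernoulli'`. -/
theorem sum_modCoeff_mul_pow (m : ℕ) (x : ℝ) :
    ∑ k ∈ Finset.range (m + 1), modCoeff k * x ^ k * (x ^ (m - k) / ((m - k).factorial : ℝ)) =
      (-2) ^ m * (bernoulliB m (-1 / 2) : ℝ) * (x ^ m / (m.factorial : ℝ)) := by
  have h : ((∑ k ∈ Finset.range (m + 1), (m.choose k : ℚ) * (-2) ^ k * bernoulli' k : ℚ) : ℝ) =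
      (((-2) ^ m * bernoulliB m (-1 / 2) : ℚ) : ℝ) := by rw [sum_choose_mul_bernoulli']
  push_cast at h
  rw [← h, Finset.sum_mul]
  refine Finset.sum_congr rfl fun k hk => ?_
  have hk' : k ≤ m := Nat.lt_succ_iff.1 (Finset.mem_range.1 hk)
  have h1 : (k.factorial : ℝ) ≠ 0 := by exact_mod_cast k.factorial_ne_zero
  have h2 : ((m - k).factorial : ℝ) ≠ 0 := by exact_mod_cast (m - k).factorial_ne_zero
  have h3 : (m.factorial : ℝ) ≠ 0 := by exact_mod_cast m.factorial_ne_zero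
  have h4 : (x : ℝ) ^ m = x ^ k * x ^ (m - k) := by rw [← pow_add, Nat.add_sub_cancel' hk']
  rw [modCoeff, Nat.cast_choose ℝ hk', h4]
  field_simp

theorem exists_sum_realPolylog_eq (m : ℕ) :
    ∃ g : ℝ → ℝ, ContDiff ℝ ∞ g ∧ ∀ x, x ≠ 0 →
      ∑ k ∈ Finset.range (m + 1), modCoeff k * x ^ k * realPolylog (m + 1 - k - 1) x =
        -(-2 : ℝ) ^ m * (bernoulliB m (-1 / 2) : ℝ) * (x ^ m / (m.factorial : ℝ)) *
          Real.log |x| + g x := by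
  -- The remainder of λi_n combines the smooth remainders of the individual li with the polynomial
  -- coefficients.
  choose S hS h using exists_realPolylog_eq
  refine ⟨fun x => ∑ k ∈ Finset.range (m + 1), modCoeff k * x ^ k * S (m - k) x,
    ContDiff.sum fun k _ => ContDiff.mul (by fun_prop) (hS _), fun x hx => ?_⟩
  have hs := sum_modCoeff_mul_pow m x
  rw [Real.log_abs, neg_mul, neg_mul, neg_mul, ← hs, Finset.sum_mul, ← Finset.sum_neg_distrib,
    ← Finset.sum_add_distrib]
  refine Finset.sum_congr rfl fun k _ => ?_
  rw [show m + 1 - k - 1 = m - k by omega, h _ x hx]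
  ring

theorem exists_isGivenBy_modifiedPolylogDist (m : ℕ) :
    ∃ g : ℝ → ℝ, ContDiff ℝ ∞ g ∧
      IsGivenBy (modifiedPolylogDist (m + 1)) (fun x =>
        ((-(-2 : ℝ) ^ m * (bernoulliB m (-1 / 2) : ℝ) * (x ^ m / (m.factorial : ℝ)) *
          Real.log |x| + g x : ℝ) : ℂ)) ∧
      ∀ x : ℝ, x ≠ 0 → (classicalModifiedSum (m + 1) (Real.exp x : ℂ)).re =
        -(-2 : ℝ) ^ m * (bernoulliB m (-1 / 2) : ℝ) * (x ^ m / (m.factorial : ℝ)) *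
          Real.log |x| + g x := by
  obtain ⟨g, hg, h⟩ := exists_sum_realPolylog_eq m
  refine ⟨g, hg, (isGivenBy_modifiedPolylogDist (m + 1)).congr_ae ?_, fun x hx => ?_⟩
  · have : ∀ᵐ x : ℝ, x ≠ 0 := by simp [ae_iff]
    filter_upwards [this] with x hx
    rw [h x hx]
  · rw [classicalModifiedSum_exp_re, h x hx]

end Polylog
end

theorem mainTheorem4 :
    -- for even `n`, `λi_n` is a smooth function, equal at `x ≠ 0` to the classical sum at `z = e^x`
    (∀ n : ℕ, Even n → ∃ f : ℝ → ℝ, ContDiff ℝ ∞ f ∧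
      Polylog.IsGivenBy (Polylog.modifiedPolylogDist n) (fun x => (f x : ℂ)) ∧
      ∀ x : ℝ, x ≠ 0 → f x = (Polylog.classicalModifiedSum n (Real.exp x : ℂ)).re) ∧
    -- the singular part of `λi_n`
    (∀ n : ℕ, 1 ≤ n → ∃ g : ℝ → ℝ, ContDiff ℝ ∞ g ∧
      Polylog.IsGivenBy (Polylog.modifiedPolylogDist n) (fun x =>
        ((-(-2 : ℝ) ^ (n - 1) * (Polylog.bernoulliB (n - 1) (-1 / 2) : ℝ) *
          (x ^ (n - 1) / ((n - 1).factorial : ℝ)) * Real.log |x| + g x : ℝ) : ℂ))) ∧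
    -- `∑ B^m(-1/2) t^m / m! = t / (2 sinh (t/2))` as formal power series
    PowerSeries.mk (fun m : ℕ => Polylog.bernoulliB m (-1 / 2) / (m.factorial : ℚ)) *
        (PowerSeries.rescale (1 / 2 : ℚ) (PowerSeries.exp ℚ) -
          PowerSeries.rescale (-1 / 2 : ℚ) (PowerSeries.exp ℚ)) = PowerSeries.X ∧
    -- hence the coefficient of the singular part vanishes for even `n`
    (∀ m : ℕ, Odd m → Polylog.bernoulliB m (-1 / 2) = 0) := by
  refine ⟨fun n hn => ?_, fun n hn => ?_, Polylog.bernoulliB_generating_function,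
    fun m hm => Polylog.bernoulliB_neg_half_of_odd hm⟩
  · cases n with
    | zero =>
      refine ⟨fun _ => 0, contDiff_const, ?_, fun x _ => ?_⟩
      · simpa using Polylog.isGivenBy_modifiedPolylogDist 0
      · simp [Polylog.classicalModifiedSum]
    | succ m =>
      obtain ⟨g, hg, hT, hc⟩ := Polylog.exists_isGivenBy_modifiedPolylogDist m
      -- The Bernoulli index is n - 1, so even n selects the odd, vanishing values.
      have hm : Odd m := by rwa [Nat.even_add_one, Nat.not_even_iff_odd] at hn
      simp only [Polylog.bernoulliB_neg_half_of_odd hm, Rat.cast_zero, mul_zero, zero_mul,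
        zero_add] at hT hc
      exact ⟨g, hg, hT, fun x hx => (hc x hx).symm⟩
  · obtain ⟨m, rfl⟩ := Nat.exists_eq_add_of_le' hn
    obtain ⟨g, hg, hT, -⟩ := Polylog.exists_isGivenBy_modifiedPolylogDist m
    exact ⟨g, hg, hT⟩
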